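/- Let $\Bbbk$ be a commutative ring. For $n\ge 0$ let $F_n=\mathbb{Z}^{*n}$ be the free group on $n$ letters, $V_n=\Bbbk^n=(F_n/[F_n,F_n])\otimes\Bbbk$, and let $\mathrm{Aut}(F_n)$ act diagonally on $B_{l,q}(n)=\mathrm{Hom}_\Bbbk(V_n^{\otimes l},V_n^{\otimes q})$. **The stable cohomology.** Let $i_n:F_n\to F_{n+1}$ be the inclusion of the first $n$ letters and $p_n:F_{n+1}\to F_n$ the projection onto them. Let $\alpha_n:H^i(\mathrm{Aut}(F_{n+1});B_{l,q}(n+1))\to H^i(\mathrm{Aut}(F_n);B_{l,q}(n))$ be restriction along $\varphi\mapsto\varphi*\mathbb{Z}$ followed by $f\mapsto p_n^{\otimes q}\circ f\circ i_n^{\otimes l}$, and put $\mathcal{H}(q,l)^i=\lim_n H^i(\mathrm{Aut}(F_n);B_{l,q}(n))$ along the maps $\alpha_n$. Thus an element $x$ of $\mathcal H(q,l)^i$ is an $\alpha$-compatible sequence $(x_n)$, determined by its components for all large $n$. The operations of $\mathcal{H}$ are the following. * The symmetric groups act by place permutations, and $1\in\mathcal{H}(q,q)^0$ is the class of the identities.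 * The horizontal composition $x\otimes y$ is the cup product followed by $\mathrm{Hom}(M_1,M_2)\otimes\mathrm{Hom}(N_1,N_2)\to\mathrm{Hom}(M_1\otimes N_1,M_2\otimes N_2)$. * The vertical composition $\mathcal{H}(l,m)^i\otimes\mathcal{H}(q,l)^j\to\mathcal{H}(q,m)^{i+j}$, $x\otimes y\mapsto x\circ y$, is induced, for large $n$, by the cup product $x_n\cup y_n$ followed by the composition map $f\otimes g\mapsto g\circ f$ from $B_{m,l}(n)\otimes B_{l,q}(n)$ to $B_{m,q}(n)$. * For $x\in\mathcal{H}(q,l)$ and $y\in\mathcal{H}(q-1,l-1)$ of the same degree, $y=\xi^i_j(x)$ means that, for all large $n$, $y_n$ is the image of $x_n$ under the contraction of the $i$-th factor $V_n$ with the $j$-th factor $V_n^*$ of $B_{l,q}(n)\cong(V_n^*)^{\otimes l}\otimes V_n^{\otimes q}$. There is at most one such $y$. For $h\in\mathcal H(2,1)^1$, the sub-wheeled PROP of $\mathcal{H}$ generated by $h$ is the smallest family of graded submodules of the $\mathcal{H}(q,l)$ that contains $h$ and the identities and is closed under the symmetric groups, horizontal and vertical composition, and contractions (whenever the contraction of an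 element exists in $\mathcal{H}$). **Kawazumi's classes.** For every $n$ let $\theta^{(n)}$ be a Magnus expansion of $F_n$, that is, a group homomorphism from $F_n$ to the units of $\prod_{m\ge0}V_n^{\otimes m}$ with $\theta^{(n)}(\gamma)=1+[\gamma]+\theta^{(n)}_2(\gamma)+\cdots$. The first Johnson map $\tau_1:\mathrm{Aut}(F_n)\to\mathrm{Hom}(V_n,V_n^{\otimes2})$, $\tau_1(\varphi)([\gamma])=\theta^{(n)}_2(\gamma)-\varphi^{\otimes2}\theta^{(n)}_2(\varphi^{-1}(\gamma))$, is a $1$-cocycle. Put $h_1^{(n)}=[\tau_1]$ and, for $p\ge1$, $$h_p^{(n)}=(\varsigma_p)_*\big((h_1^{(n)})^{\cup p}\big)\in H^p(\mathrm{Aut}(F_n);\mathrm{Hom}(V_n,V_n^{\otimes p+1})),$$ $$\varsigma_p(u_1\otimes\cdots\otimes u_p)=(u_1\otimes1_{V_n^{\otimes p-1}})\circ(u_2\otimes1_{V_n^{\otimes p-2}})\circ\cdots\circ(u_{p-1}\otimes1_{V_n})\circ u_p .$$ Let $\overline{h_p}^{(n)}\in H^p(\mathrm{Aut}(F_n);V_n^{\otimes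 p})$ be the image of $h_p^{(n)}$ under the contraction of $V_n^*$ with the first factor of $V_n^{\otimes p+1}$. **Proposition.** There are elements $h_p\in\mathcal{H}(p+1,1)^p$ and $\overline{h_p}\in\mathcal{H}(p,0)^p$ for $p\ge1$ whose components at every level $n$ are $h_p^{(n)}$ and $\overline{h_p}^{(n)}$ (in particular those of $h_1$ are the classes $[\tau_1]$), and for every $p\ge1$: 1. $h_1\circ(h_p\otimes1)=(-1)^p\,h_{p+1}$, that is, $h_{p+1}=(-1)^p\,h_1\circ(h_p\otimes1)$; 2. $\overline{h_p}=\xi^1_1(h_p)$; 3. $h_p$ and $\overline{h_p}$ lie in the sub-wheeled PROP $\mathcal{K}$ of $\mathcal{H}$ generated by $h_1$. -/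

import Mathlib

universe u
open CategoryTheory
open scoped TensorProduct MonoidalCategory

noncomputable section

namespace StableAut

section Cup

variable {k G : Type u} [CommRing k] [Group G]

/-- The cup product `(a ∪ b)(x₁, …, xₘ) = a(x₁, …, xᵢ) ⊗ x₁⋯xᵢ • b(xᵢ₊₁, …, xₘ)`, `m = i + j`,
of inhomogeneous cochains. -/
def cupCochain {A B : Rep.{u} k G} {i j m : ℕ} (h : i + j = m)
    (a : (Fin i → G) → A) (b : (Fin j → G) → B) : (Fin m → G) → (A ⊗ B : Rep.{u} k G) :=
  fun x => a (fun s => x ⟨s, by omega⟩) ⊗ₜ[k]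
    B.ρ (List.ofFn fun s : Fin i => x ⟨s, by omega⟩).prod (b fun s => x ⟨i + s, by omega⟩)

def prd (i : ℕ) (X : ℕ → G) : G := (List.ofFn fun s : Fin i => X s).prod
def sh (i : ℕ) (X : ℕ → G) : ℕ → G := fun s => X (i + s)
def ct (c : ℕ) (X : ℕ → G) : ℕ → G :=
  fun s => if s < c then X s else if s = c then X s * X (s + 1) else X (s + 1)
def re (m : ℕ) (X : ℕ → G) : Fin m → G := fun s => X s

lemma prd_succ (i : ℕ) (X : ℕ → G) : prd (i + 1) X = prd i X * X i := by
  rw [prd, List.ofFn_succ', List.concat_eq_append, List.prod_append]; simp [prd]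

lemma prd_succ' (i : ℕ) (X : ℕ → G) : prd (i + 1) X = X 0 * prd i (sh 1 X) := by
  simp [prd, List.ofFn_succ, sh, add_comm]

lemma prd_ct (i : ℕ) : ∀ (c : ℕ) (_ : c < i) (X : ℕ → G),
    prd i (ct c X) = prd (i + 1) X := by
  induction i with
  | zero => intro c hc; omega
  | succ i ih =>
    intro c hc X
    rcases Nat.lt_or_ge c i with h | h
    · rw [prd_succ, ih c h, prd_succ (i + 1), ct, if_neg (by omega), if_neg (by omega)]
    · obtain rfl : c = i := by omega
      rw [prd_succ, prd_succ (c + 1), prd_succ c, mul_assoc]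
      congr 1
      · unfold prd ct
        congr 2; funext s; simp
      · simp [ct]

lemma re_ct_le (i c : ℕ) (hc : i ≤ c) (X : ℕ → G) : re i (ct c X) = re i X := by
  funext s; simp [re, ct, show (s : ℕ) < c by omega]

lemma contractNth_re (m : ℕ) (c : Fin (m + 1)) (X : ℕ → G) :
    Fin.contractNth c (· * ·) (re (m + 1) X) = re m (ct c X) := by
  funext s; simp [Fin.contractNth, re, ct]

lemma d_re (A : Rep.{u} k G) (m : ℕ) (f : (Fin m → G) → A) (X : ℕ → G) :
    inhomogeneousCochains.d A m f (re (m + 1) X) = A.ρ (X 0) (f (re m (sh 1 X))) +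
      ∑ c ∈ Finset.range (m + 1), (-1 : k) ^ (c + 1) • f (re m (ct c X)) := by
  rw [inhomogeneousCochains.d_hom_apply, Finset.sum_range]
  simp only [contractNth_re]
  congr 3
  funext s; simp [re, sh, add_comm]

lemma cup_re {A B : Rep.{u} k G} {i j m : ℕ} (h : i + j = m)
    (a : (Fin i → G) → A) (b : (Fin j → G) → B) (X : ℕ → G) :
    cupCochain h a b (re m X) =
      a (re i X) ⊗ₜ[k] B.ρ (prd i X) (b (re j (sh i X))) := rfl

lemma exists_re (m : ℕ) (x : Fin m → G) : ∃ X : ℕ → G, re m X = x :=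
  ⟨fun s => if h : s < m then x ⟨s, h⟩ else 1, by funext s; simp [re]⟩

/-- The Leibniz rule. -/
theorem d_cupCochain {A B : Rep.{u} k G} {i j m : ℕ} (h : i + j = m)
    (a : (Fin i → G) → A) (b : (Fin j → G) → B) :
    (inhomogeneousCochains.d (A ⊗ B) m (cupCochain h a b) : (Fin (m + 1) → G) → _) =
      cupCochain (i := i + 1) (j := j) (by omega) (inhomogeneousCochains.d A i a) b +
      (-1 : k) ^ i • cupCochain (i := i) (j := j + 1) (by omega) a
        (inhomogeneousCochains.d B j b) := by
  funext x
  obtain ⟨X, rfl⟩ := exists_re _ x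
  rw [Pi.add_apply, Pi.smul_apply, cup_re, cup_re, d_re, d_re, d_re]
  simp only [cup_re]
  have e1 : (A ⊗ B : Rep.{u} k G).ρ (X 0)
      (a (re i (sh 1 X)) ⊗ₜ[k] B.ρ (prd i (sh 1 X)) (b (re j (sh i (sh 1 X))))) =
      A.ρ (X 0) (a (re i (sh 1 X))) ⊗ₜ[k] B.ρ (prd (i + 1) X) (b (re j (sh (i + 1) X))) := by
    rw [prd_succ', map_mul]
    have : sh i (sh 1 X) = sh (i + 1) X := by funext s; simp only [sh]; congr 1; omega
    rw [this]
    rfl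
  have e2 : ∑ c ∈ Finset.range i, (-1 : k) ^ (c + 1) • (a (re i (ct c X)) ⊗ₜ[k]
        B.ρ (prd i (ct c X)) (b (re j (sh i (ct c X))))) =
      (∑ c ∈ Finset.range i, (-1 : k) ^ (c + 1) • a (re i (ct c X))) ⊗ₜ[k]
        B.ρ (prd (i + 1) X) (b (re j (sh (i + 1) X))) := by
    rw [TensorProduct.sum_tmul]
    refine Finset.sum_congr rfl fun c hc => ?_
    have hc := Finset.mem_range.1 hc
    have : sh i (ct c X) = sh (i + 1) X := by
      funext s; simp only [sh, ct]; rw [if_neg (by omega), if_neg (by omega)]; congr 1; omega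
    rw [prd_ct i c hc, this, TensorProduct.smul_tmul']
  have e3 : ∑ c ∈ Finset.range (j + 1), (-1 : k) ^ (i + c + 1) • (a (re i (ct (i + c) X)) ⊗ₜ[k]
        B.ρ (prd i (ct (i + c) X)) (b (re j (sh i (ct (i + c) X))))) =
      (-1 : k) ^ i • (a (re i X) ⊗ₜ[k] B.ρ (prd i X)
        (∑ c ∈ Finset.range (j + 1), (-1 : k) ^ (c + 1) • b (re j (ct c (sh i X))))) := by
    rw [map_sum, TensorProduct.tmul_sum, Finset.smul_sum]
    refine Finset.sum_congr rfl fun c hc => ?_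
    have h1 : sh i (ct (i + c) X) = ct c (sh i X) := by
      funext s; simp only [sh, ct]
      simp only [Nat.add_lt_add_iff_left, Nat.add_left_cancel_iff, add_assoc]
    have h2 : prd i (ct (i + c) X) = prd i X := by
      have := re_ct_le i (i + c) (by omega) X
      simp only [prd]; congr 2
    rw [h1, h2, re_ct_le i (i + c) (by omega), map_smul, TensorProduct.tmul_smul, smul_smul,
      add_assoc, pow_add]
  have hs : m + 1 = i + (j + 1) := by omega
  rw [e1, hs, Finset.sum_range_add, e2]
  erw [e3]
  rw [Finset.sum_range_succ (n := i), re_ct_le i i le_rfl, map_add, TensorProduct.tmul_add,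
    TensorProduct.add_tmul, TensorProduct.add_tmul, smul_add]
  have e4 : B.ρ (prd i X) (B.ρ (sh i X 0) (b (re j (sh 1 (sh i X))))) =
      B.ρ (prd (i + 1) X) (b (re j (sh (i + 1) X))) := by
    rw [prd_succ, map_mul]
    have : sh 1 (sh i X) = sh (i + 1) X := by funext s; simp only [sh]; congr 1; omega
    rw [this]; rfl
  rw [e4, ← TensorProduct.smul_tmul', pow_succ]
  simp only [mul_neg, mul_one, neg_smul]
  abel


open groupCohomology

theorem pi_eq_zero_iff {A : Rep.{u} k G} {m n : ℕ} (h : (ComplexShape.up ℕ).prev n = m)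
    (z : cocycles A n) : π A n z = 0 ↔ ∃ c : (inhomogeneousCochains A).X m,
      (inhomogeneousCochains A).toCycles m n c = z := by
  have hS : (ShortComplex.mk _ _ ((inhomogeneousCochains A).toCycles_comp_homologyπ m n)).Exact :=
    ShortComplex.exact_of_g_is_cokernel _ ((inhomogeneousCochains A).homologyIsCokernel _ n h)
  rw [ShortComplex.moduleCat_exact_iff] at hS
  refine ⟨fun h => hS z h, ?_⟩
  rintro ⟨c, rfl⟩
  exact (ShortComplex.mk _ _
      ((inhomogeneousCochains A).toCycles_comp_homologyπ _ n)).moduleCat_zero_apply c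

theorem iCocycles_injective (A : Rep.{u} k G) (n : ℕ) : Function.Injective (iCocycles A n) :=
  (ModuleCat.mono_iff_injective _).1 inferInstance

theorem d_iCocycles {A : Rep.{u} k G} {n : ℕ} (z : cocycles A n) :
    inhomogeneousCochains.d A n (iCocycles A n z) = 0 := by
  have := (inhomogeneousCochains A).iCycles_d n (n + 1)
  rw [inhomogeneousCochains.d_def] at this
  exact congr($(this).hom z)

theorem pi_succ_eq_zero_iff {A : Rep.{u} k G} {n : ℕ} (z : cocycles A (n + 1)) :
    π A (n + 1) z = 0 ↔ ∃ c : (Fin n → G) → A,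
      inhomogeneousCochains.d A n c = iCocycles A (n + 1) z := by
  rw [pi_eq_zero_iff (CochainComplex.prev_nat_succ n)]
  refine exists_congr fun c => ?_
  have := (inhomogeneousCochains A).toCycles_i n (n + 1)
  rw [inhomogeneousCochains.d_def] at this
  rw [← this]
  exact ((iCocycles_injective A (n + 1)).eq_iff).symm

theorem pi_zero_eq_zero_iff {A : Rep.{u} k G} (z : cocycles A 0) :
    π A 0 z = 0 ↔ iCocycles A 0 z = 0 := by
  rw [pi_eq_zero_iff CochainComplex.prev_nat_zero]
  have := (inhomogeneousCochains A).toCycles_i 0 0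
  rw [(inhomogeneousCochains A).shape 0 0 (by simp)] at this
  constructor
  · rintro ⟨c, rfl⟩
    exact congr($(this).hom c)
  · intro h
    exact ⟨0, by rw [map_zero]; exact (iCocycles_injective A 0 (by rw [h, map_zero])).symm⟩

theorem cup_zero_left {A B : Rep.{u} k G} {i j m : ℕ} (h : i + j = m)
    (b : (Fin j → G) → B) : cupCochain (A := A) h 0 b = 0 := by
  funext x; exact TensorProduct.zero_tmul _ _

theorem cup_zero_right {A B : Rep.{u} k G} {i j m : ℕ} (h : i + j = m)
    (a : (Fin i → G) → A) : cupCochain (B := B) h a 0 = 0 := by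
  funext x; exact (congrArg _ (map_zero _)).trans (TensorProduct.tmul_zero _ _)

theorem cup_closed {A B : Rep.{u} k G} {i j m : ℕ} (h : i + j = m) (a : cocycles A i)
    (b : cocycles B j) : inhomogeneousCochains.d (A ⊗ B) m
      (cupCochain h (iCocycles A i a) (iCocycles B j b)) = 0 := by
    have := d_cupCochain h (iCocycles A i a : (Fin i → G) → A) (iCocycles B j b)
    rw [d_iCocycles, d_iCocycles] at this
    refine this.trans ((congrArg₂ (· + ·) (cup_zero_left _ _)
      (congrArg _ (cup_zero_right _ _))).trans ?_)
    simp

/-- The cup product of cocycles. -/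
def cupCocycle {A B : Rep.{u} k G} {i j m : ℕ} (h : i + j = m) (a : cocycles A i)
    (b : cocycles B j) : cocycles (A ⊗ B) m :=
  cocyclesMk (cupCochain h (iCocycles A i a) (iCocycles B j b)) (cup_closed h a b)

theorem iCocycles_cupCocycle {A B : Rep.{u} k G} {i j m : ℕ} (h : i + j = m) (a : cocycles A i)
    (b : cocycles B j) : iCocycles (A ⊗ B) m (cupCocycle h a b) =
      cupCochain h (iCocycles A i a) (iCocycles B j b) :=
  iCocycles_mk (A := A ⊗ B) _ (cup_closed h a b)

theorem pi_surjective (A : Rep.{u} k G) (i : ℕ) : Function.Surjective (π A i) :=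
  fun x => groupCohomology_induction_on x fun y => ⟨y, rfl⟩

/-- The cup product `∪ : Hⁱ(G; A) × Hʲ(G; B) → Hⁱ⁺ʲ(G; A ⊗ B)`, computed on representing
cocycles; by `cup_pi` it does not depend on their choice. -/
def cup {A B : Rep.{u} k G} {i j m : ℕ} (h : i + j = m) (x : groupCohomology A i)
    (y : groupCohomology B j) : groupCohomology (A ⊗ B) m :=
  π (A ⊗ B) m (cupCocycle h (Function.surjInv (pi_surjective A i) x)
    (Function.surjInv (pi_surjective B j) y))

theorem cup_left {A B : Rep.{u} k G} {i j m : ℕ} (h : i + j = m) (a a' : cocycles A i)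
    (b : cocycles B j) (haa : π A i a = π A i a') :
    π (A ⊗ B) m (cupCocycle h a b) = π (A ⊗ B) m (cupCocycle h a' b) := by
  have h0 : π A i (a - a') = 0 := by rw [map_sub, haa, sub_self]
  rw [← sub_eq_zero, ← map_sub]
  have hs : iCocycles (A ⊗ B) m (cupCocycle h a b - cupCocycle h a' b) =
      cupCochain h (iCocycles A i (a - a')) (iCocycles B j b) := by
    rw [map_sub, iCocycles_cupCocycle, iCocycles_cupCocycle, map_sub]
    funext x
    exact (TensorProduct.sub_tmul _ _ _).symm
  cases i with
  | zero =>
    rw [pi_zero_eq_zero_iff] at h0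
    have : cupCocycle h a b - cupCocycle h a' b = 0 := by
      apply iCocycles_injective
      rw [hs, h0, map_zero]
      funext x
      exact TensorProduct.zero_tmul _ _
    rw [this, map_zero]
  | succ i =>
    obtain rfl | ⟨m, rfl⟩ : m = 0 ∨ ∃ m', m = m' + 1 := by cases m <;> simp
    · omega
    obtain ⟨c, hc⟩ := (pi_succ_eq_zero_iff _).1 h0
    refine (pi_succ_eq_zero_iff _).2 ⟨cupCochain (by omega) c (iCocycles B j b), ?_⟩
    rw [hs, ← hc]
    refine (d_cupCochain _ _ _).trans ?_
    rw [d_iCocycles]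
    refine (congrArg _ (congrArg _ (cup_zero_right _ _))).trans ?_
    rw [smul_zero, add_zero]

theorem cup_right {A B : Rep.{u} k G} {i j m : ℕ} (h : i + j = m) (a : cocycles A i)
    (b b' : cocycles B j) (hbb : π B j b = π B j b') :
    π (A ⊗ B) m (cupCocycle h a b) = π (A ⊗ B) m (cupCocycle h a b') := by
  have h0 : π B j (b - b') = 0 := by rw [map_sub, hbb, sub_self]
  rw [← sub_eq_zero, ← map_sub]
  have hs : iCocycles (A ⊗ B) m (cupCocycle h a b - cupCocycle h a b') =
      cupCochain h (iCocycles A i a) (iCocycles B j (b - b')) := by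
    rw [map_sub, iCocycles_cupCocycle, iCocycles_cupCocycle, map_sub]
    funext x
    refine (TensorProduct.tmul_sub _ _ _).symm.trans ?_
    rw [← map_sub]; rfl
  cases j with
  | zero =>
    rw [pi_zero_eq_zero_iff] at h0
    have : cupCocycle h a b - cupCocycle h a b' = 0 := by
      apply iCocycles_injective
      rw [hs, h0, map_zero]
      exact cup_zero_right _ _
    rw [this, map_zero]
  | succ j =>
    obtain rfl | ⟨m, rfl⟩ : m = 0 ∨ ∃ m', m = m' + 1 := by cases m <;> simp
    · omega
    obtain ⟨c, hc⟩ := (pi_succ_eq_zero_iff _).1 h0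
    refine (pi_succ_eq_zero_iff _).2
      ⟨(-1 : k) ^ i • cupCochain (by omega) (iCocycles A i a) c, ?_⟩
    rw [hs, ← hc, map_smul]
    refine (congrArg _ (d_cupCochain _ _ _)).trans ?_
    rw [d_iCocycles, smul_add, smul_smul, ← mul_pow, neg_one_mul, neg_neg, one_pow, one_smul]
    refine (congrArg (· + _) (congrArg _ (cup_zero_left _ _))).trans ?_
    rw [smul_zero, zero_add]

theorem cup_pi {A B : Rep.{u} k G} {i j m : ℕ} (h : i + j = m) (a : cocycles A i)
    (b : cocycles B j) : cup h (π A i a) (π B j b) = π (A ⊗ B) m (cupCocycle h a b) :=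
  (cup_left h _ a _ (Function.surjInv_eq _ _)).trans (cup_right h a _ b (Function.surjInv_eq _ _))

end Cup

section CupMap

open groupCohomology

variable {k G H : Type u} [CommRing k] [Group G] [Group H]

theorem iCocycles_cocyclesMap {A : Rep.{u} k H} {B : Rep.{u} k G} (f : G →* H)
    (φ : Rep.res f A ⟶ B) (i : ℕ) (a : cocycles A i) (x : Fin i → G) :
    (iCocycles B i (cocyclesMap f φ i a) : (Fin i → G) → B) x =
      φ.hom ((iCocycles A i a : (Fin i → H) → A) (f ∘ x)) :=
  congr($(HomologicalComplex.cyclesMap_i (cochainsMap f φ) i).hom a x)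

theorem map_pi {A : Rep.{u} k H} {B : Rep.{u} k G} (f : G →* H)
    (φ : Rep.res f A ⟶ B) (i : ℕ) (a : cocycles A i) :
    map f φ i (π A i a) = π B i (cocyclesMap f φ i a) :=
  congr($(π_map f φ i).hom a)

/-- The map on cohomology induced by a morphism of representations of `G`. -/
def coh {A B : Rep.{u} k G} (f : A ⟶ B) (i : ℕ) : groupCohomology A i →ₗ[k] groupCohomology B i :=
  (map (A := A) (MonoidHom.id G) f i).hom

theorem map_coh {A B : Rep.{u} k H} {A' B' : Rep.{u} k G} (s : G →* H) (φ : Rep.res s A ⟶ A')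
    (ψ : Rep.res s B ⟶ B') (f : A ⟶ B) (f' : A' ⟶ B')
    (h : ∀ a : A, ψ.hom (f.hom a) = f'.hom (φ.hom a)) (i : ℕ) (x : groupCohomology A i) :
    map s ψ i (coh f i x) = coh f' i (map s φ i x) := by
  obtain ⟨a, rfl⟩ := pi_surjective _ _ x
  have h1 : coh f i (π A i a) = π B i (cocyclesMap (A := A) (MonoidHom.id H) f i a) :=
    map_pi (A := A) (MonoidHom.id H) f i a
  have h2 (b) : coh f' i (π A' i b) = π B' i (cocyclesMap (A := A') (MonoidHom.id G) f' i b) :=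
    map_pi (A := A') (MonoidHom.id G) f' i b
  rw [map_pi, h1, h2, map_pi]
  congr 1
  apply iCocycles_injective
  funext x
  rw [iCocycles_cocyclesMap, iCocycles_cocyclesMap (A := A) (MonoidHom.id H) f,
    iCocycles_cocyclesMap (A := A') (MonoidHom.id G) f', iCocycles_cocyclesMap]
  exact h _

/-- The class in `H⁰` of an invariant element. -/
def invClass {A : Rep.{u} k G} (v : A) (hv : ∀ g, A.ρ g v = v) : groupCohomology A 0 :=
  π A 0 (cocyclesMk (fun _ => v) (by
    funext g
    rw [inhomogeneousCochains.d_hom_apply]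
    simp [hv]
    rfl))

theorem map_invClass {A : Rep.{u} k H} {A' : Rep.{u} k G} (s : G →* H) (φ : Rep.res s A ⟶ A')
    (v : A) (hv : ∀ g, A.ρ g v = v) (v' : A') (hv' : ∀ g, A'.ρ g v' = v') (h : φ.hom v = v') :
    map s φ 0 (invClass v hv) = invClass v' hv' := by
  rw [invClass, invClass, map_pi]
  congr 1
  apply iCocycles_injective
  funext x
  rw [iCocycles_cocyclesMap, iCocycles_mk, iCocycles_mk]
  exact h

/-- The cup product is natural. -/
theorem map_cup {A B : Rep.{u} k H} {A' B' : Rep.{u} k G} (f : G →* H) (φ : Rep.res f A ⟶ A')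
    (ψ : Rep.res f B ⟶ B') (χ : Rep.res f (A ⊗ B) ⟶ A' ⊗ B')
    (hχ : ∀ (a : A) (b : B), χ.hom (a ⊗ₜ[k] b) = φ.hom a ⊗ₜ[k] ψ.hom b) {i j m : ℕ}
    (h : i + j = m) (x : groupCohomology A i) (y : groupCohomology B j) :
    map f χ m (cup h x y) = cup h (map f φ i x) (map f ψ j y) := by
  obtain ⟨a, rfl⟩ := pi_surjective _ _ x
  obtain ⟨b, rfl⟩ := pi_surjective _ _ y
  rw [map_pi, map_pi, cup_pi, cup_pi, map_pi]
  congr 1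
  apply iCocycles_injective
  funext x
  rw [iCocycles_cupCocycle, iCocycles_cocyclesMap, iCocycles_cupCocycle]
  simp only [cupCochain]
  rw [hχ, iCocycles_cocyclesMap, iCocycles_cocyclesMap]
  have hp : (List.ofFn fun s : Fin i => (f ∘ x) ⟨s, by omega⟩).prod =
      f (List.ofFn fun s : Fin i => x ⟨s, by omega⟩).prod := by
    rw [map_list_prod, List.map_ofFn]; rfl
  rw [hp]
  exact congrArg _ (Rep.hom_comm_apply ψ _ _)

end CupMap
end StableAut

namespace StableAut

section Tensor

variable (k : Type u) [CommRing k]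

/-- The tensor power `(kⁿ)^{⊗ q}`. -/
abbrev T (n q : ℕ) : Type u := ⨂[k]^q (Fin n → k)

variable {k}

/-- The map `g^{⊗ q}`. -/
def tmap {n m : ℕ} (q : ℕ) (g : (Fin n → k) →ₗ[k] (Fin m → k)) : T k n q →ₗ[k] T k m q :=
  PiTensorProduct.map fun _ => g

@[simp] theorem tmap_tprod {n m q : ℕ} (g : (Fin n → k) →ₗ[k] (Fin m → k)) (v : Fin q → Fin n → k) :
    tmap q g (PiTensorProduct.tprod k v) = PiTensorProduct.tprod k fun s => g (v s) :=
  PiTensorProduct.map_tprod _ _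

theorem tmap_comp {n m r : ℕ} (q : ℕ) (g : (Fin m → k) →ₗ[k] (Fin r → k))
    (f : (Fin n → k) →ₗ[k] (Fin m → k)) : tmap q (g ∘ₗ f) = tmap q g ∘ₗ tmap q f :=
  PiTensorProduct.map_comp _ _

@[simp] theorem tmap_id (n q : ℕ) :
    tmap q (LinearMap.id : (Fin n → k) →ₗ[k] (Fin n → k)) = LinearMap.id :=
  PiTensorProduct.map_id

/-- The tensor product `f ⊗ g` of linear maps, under `V^{⊗ a} ⊗ V^{⊗ b} = V^{⊗ (a + b)}`. -/
def tens {n n' l₁ l₂ q₁ q₂ : ℕ} (f : T k n l₁ →ₗ[k] T k n' q₁) (g : T k n l₂ →ₗ[k] T k n' q₂) :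
    T k n (l₁ + l₂) →ₗ[k] T k n' (q₁ + q₂) :=
  TensorPower.mulEquiv.toLinearMap ∘ₗ TensorProduct.map f g ∘ₗ TensorPower.mulEquiv.symm.toLinearMap

theorem tens_mulEquiv {n n' l₁ l₂ q₁ q₂ : ℕ} (f : T k n l₁ →ₗ[k] T k n' q₁)
    (g : T k n l₂ →ₗ[k] T k n' q₂) (a : T k n l₁) (b : T k n l₂) :
    tens f g (TensorPower.mulEquiv (a ⊗ₜ[k] b)) = TensorPower.mulEquiv (f a ⊗ₜ[k] g b) := by
  simp [tens]

theorem tens_comp {n n' n'' l₁ l₂ q₁ q₂ r₁ r₂ : ℕ} (f' : T k n' q₁ →ₗ[k] T k n'' r₁)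
    (g' : T k n' q₂ →ₗ[k] T k n'' r₂) (f : T k n l₁ →ₗ[k] T k n' q₁)
    (g : T k n l₂ →ₗ[k] T k n' q₂) : tens (f' ∘ₗ f) (g' ∘ₗ g) = tens f' g' ∘ₗ tens f g := by
  ext v
  simp [tens, TensorProduct.map_comp]

theorem tmap_add {n m : ℕ} (q r : ℕ) (g : (Fin n → k) →ₗ[k] (Fin m → k)) :
    tmap (q + r) g = tens (tmap q g) (tmap r g) := by
  have h : tmap (q + r) g ∘ₗ TensorPower.mulEquiv.toLinearMap =
      tens (tmap q g) (tmap r g) ∘ₗ TensorPower.mulEquiv.toLinearMap := by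
    refine TensorProduct.ext (PiTensorProduct.ext (MultilinearMap.ext fun a =>
      PiTensorProduct.ext (MultilinearMap.ext fun b => ?_)))
    have h1 := TensorPower.tprod_mul_tprod k a b
    have h2 := TensorPower.tprod_mul_tprod k (fun s => g (a s)) (fun s => g (b s))
    rw [TensorPower.gMul_def] at h1 h2
    change tmap (q + r) g (TensorPower.mulEquiv (PiTensorProduct.tprod k a ⊗ₜ
      PiTensorProduct.tprod k b)) = tens (tmap q g) (tmap r g) (TensorPower.mulEquiv
        (PiTensorProduct.tprod k a ⊗ₜ PiTensorProduct.tprod k b))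
    rw [tens_mulEquiv, h1, tmap_tprod, tmap_tprod, tmap_tprod, h2]
    congr 1
    funext s
    refine Fin.addCases (fun s => ?_) (fun s => ?_) s <;> simp
  refine LinearMap.ext fun x => ?_
  obtain ⟨y, rfl⟩ := TensorPower.mulEquiv.surjective x
  exact congr($h y)

/-- Insertion of the vector `x` as the `j`-th tensor factor. -/
def insertAt (n : ℕ) {l : ℕ} (j : Fin (l + 1)) : (Fin n → k) →ₗ[k] T k n l →ₗ[k] T k n (l + 1) :=
  (PiTensorProduct.lift (s := fun _ : Fin l => Fin n → k)).toLinearMap ∘ₗ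
    (PiTensorProduct.tprod k (s := fun _ : Fin (l + 1) => Fin n → k)).curryMid j

/-- Removal of the `i`-th tensor factor by applying the linear form `f` to it. -/
def removeAt (n : ℕ) {q : ℕ} (i : Fin (q + 1)) :
    Module.Dual k (Fin n → k) →ₗ[k] T k n (q + 1) →ₗ[k] T k n q :=
  (PiTensorProduct.lift (s := fun _ : Fin (q + 1) => Fin n → k)).toLinearMap ∘ₗ
    (MultilinearMap.curryMidLinearEquiv k (fun _ : Fin (q + 1) => Fin n → k) _ i).symm.toLinearMap ∘ₗ
    LinearMap.smulRightₗ.flip (PiTensorProduct.tprod k (s := fun _ : Fin q => Fin n → k))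

@[simp] theorem insertAt_tprod {n l : ℕ} (j : Fin (l + 1)) (x : Fin n → k) (v : Fin l → Fin n → k) :
    insertAt n j x (PiTensorProduct.tprod k v) = PiTensorProduct.tprod k (j.insertNth x v) := by
  simp [insertAt]

@[simp] theorem removeAt_tprod {n q : ℕ} (i : Fin (q + 1)) (f : Module.Dual k (Fin n → k))
    (v : Fin (q + 1) → Fin n → k) : removeAt n i f (PiTensorProduct.tprod k v) =
      f (v i) • PiTensorProduct.tprod k (i.removeNth v) := by
  simp [removeAt]

/-- The contraction of the `i`-th output factor with the `j`-th input factor: for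
`F = f₁ ⊗ ⋯ ⊗ f_{l+1} ⊗ v₁ ⊗ ⋯ ⊗ v_{q+1}` it gives `f_j(vᵢ)` times the same tensor without
`f_j` and `vᵢ`. -/
def contraction (n : ℕ) {q l : ℕ} (i : Fin (q + 1)) (j : Fin (l + 1)) :
    (T k n (l + 1) →ₗ[k] T k n (q + 1)) →ₗ[k] (T k n l →ₗ[k] T k n q) where
  toFun F := ∑ a : Fin n, removeAt n i (LinearMap.proj a) ∘ₗ F ∘ₗ insertAt n j (Pi.single a 1)
  map_add' F F' := by simp [LinearMap.add_comp, LinearMap.comp_add, Finset.sum_add_distrib]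
  map_smul' c F := by simp [LinearMap.smul_comp, LinearMap.comp_smul, Finset.smul_sum]

theorem tmap_insertAt {n l : ℕ} (j : Fin (l + 1)) (g : (Fin n → k) →ₗ[k] (Fin n → k))
    (x : Fin n → k) : tmap (l + 1) g ∘ₗ insertAt n j x = insertAt n j (g x) ∘ₗ tmap l g := by
  refine PiTensorProduct.ext (MultilinearMap.ext fun v => ?_)
  simp only [LinearMap.compMultilinearMap_apply, LinearMap.comp_apply, insertAt_tprod, tmap_tprod]
  congr 1
  funext s
  refine Fin.succAboveCases j ?_ (fun s => ?_) s <;> simp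

theorem removeAt_tmap {n q : ℕ} (i : Fin (q + 1)) (g : (Fin n → k) →ₗ[k] (Fin n → k))
    (f : Module.Dual k (Fin n → k)) :
    removeAt n i f ∘ₗ tmap (q + 1) g = tmap q g ∘ₗ removeAt n i (f ∘ₗ g) := by
  refine PiTensorProduct.ext (MultilinearMap.ext fun v => ?_)
  simp only [LinearMap.compMultilinearMap_apply, LinearMap.comp_apply, removeAt_tprod, tmap_tprod,
    map_smul]
  rfl

theorem contraction_equivariant {n q l : ℕ} (i : Fin (q + 1)) (j : Fin (l + 1))
    (g g' : (Fin n → k) →ₗ[k] (Fin n → k)) (hg : g' ∘ₗ g = LinearMap.id)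
    (F : T k n (l + 1) →ₗ[k] T k n (q + 1)) :
    contraction n i j (tmap (q + 1) g ∘ₗ F ∘ₗ tmap (l + 1) g') =
      tmap q g ∘ₗ contraction n i j F ∘ₗ tmap l g' := by
  let Ψ : Module.Dual k (Fin n → k) →ₗ[k] (Fin n → k) →ₗ[k] (T k n l →ₗ[k] T k n q) :=
    LinearMap.mk₂ k (fun f x => removeAt n i f ∘ₗ F ∘ₗ insertAt n j x)
      (by intros; simp [LinearMap.add_comp]) (by intros; simp [LinearMap.smul_comp])
      (by intros; simp [LinearMap.comp_add]) (by intros; simp [LinearMap.comp_smul])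
  have key : ∑ a : Fin n, Ψ (LinearMap.proj a ∘ₗ g) (g' (Pi.single a 1)) =
      ∑ b : Fin n, Ψ (LinearMap.proj b) (Pi.single b 1) := by
    have h1 (a : Fin n) : (LinearMap.proj a ∘ₗ g : Module.Dual k (Fin n → k)) =
        ∑ b, g (Pi.single b 1) a • LinearMap.proj b := by
      ext b
      simp [Finset.sum_apply, Pi.single_apply]
    have h2 (b : Fin n) : ∑ a, g (Pi.single b 1) a • g' (Pi.single a 1) = Pi.single b 1 := by
      have := congr($hg (Pi.single b 1))
      rw [LinearMap.comp_apply, LinearMap.id_apply] at this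
      conv_rhs => rw [← this]
      conv_rhs => rw [← (Pi.basisFun k (Fin n)).sum_repr (g (Pi.single b 1)), map_sum]
      simp
    simp_rw [h1, map_sum, LinearMap.sum_apply, map_smul, LinearMap.smul_apply]
    rw [Finset.sum_comm]
    refine Finset.sum_congr rfl fun b _ => ?_
    have h3 := congrArg (Ψ (LinearMap.proj b)) (h2 b)
    rw [map_sum] at h3
    simp_rw [map_smul] at h3
    exact h3
  have e1 : contraction n i j (tmap (q + 1) g ∘ₗ F ∘ₗ tmap (l + 1) g') =
      tmap q g ∘ₗ (∑ a : Fin n, Ψ (LinearMap.proj a ∘ₗ g) (g' (Pi.single a 1))) ∘ₗ tmap l g' := by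
    refine LinearMap.ext fun t => ?_
    simp only [contraction, LinearMap.coe_mk, AddHom.coe_mk, LinearMap.comp_apply,
      LinearMap.sum_apply, map_sum]
    refine Finset.sum_congr rfl fun a _ => ?_
    have h1 := congr($(tmap_insertAt j g' (Pi.single a 1)) t)
    have h2 := fun y => congr($(removeAt_tmap i g (LinearMap.proj a)) y)
    simp only [LinearMap.comp_apply] at h1 h2
    rw [h1, h2]
    rfl
  rw [e1, key]
  rfl

end Tensor

end StableAut

namespace StableAut

section FreeGroups

variable (k : Type u) [CommRing k]

/-- The class `[γ] ∈ kⁿ = (F/[F,F]) ⊗ k` of an element `γ` of the free group `F` on `n` letters. -/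
def ab {n : ℕ} (γ : FreeGroup (Fin n)) : Fin n → k :=
  (FreeGroup.lift (fun a => Multiplicative.ofAdd (Pi.single a (1 : k) : Fin n → k)) γ).toAdd

@[simp] theorem ab_of {n : ℕ} (a : Fin n) : ab k (FreeGroup.of a) = Pi.single a 1 := by
  simp [ab]

@[simp] theorem ab_mul {n : ℕ} (γ δ : FreeGroup (Fin n)) : ab k (γ * δ) = ab k γ + ab k δ := by
  simp [ab]

@[simp] theorem ab_one {n : ℕ} : ab k (1 : FreeGroup (Fin n)) = 0 := by
  simp [ab]

/-- The linear map `kⁿ → kᵐ` induced by a homomorphism of free groups. -/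
def abMap {n m : ℕ} (f : FreeGroup (Fin n) →* FreeGroup (Fin m)) : (Fin n → k) →ₗ[k] (Fin m → k) :=
  (Pi.basisFun k (Fin n)).constr k fun a => ab k (f (FreeGroup.of a))

@[simp] theorem abMap_single {n m : ℕ} (f : FreeGroup (Fin n) →* FreeGroup (Fin m)) (a : Fin n) :
    abMap k f (Pi.single a 1) = ab k (f (FreeGroup.of a)) := by
  rw [← Pi.basisFun_apply, abMap, Module.Basis.constr_basis]

/-- Homomorphisms from a free group to an additive commutative group agree if they agree on
generators. -/
theorem eq_of_additive {n : ℕ} {M : Type*} [AddCommGroup M] (f g : FreeGroup (Fin n) → M)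
    (hf : ∀ x y, f (x * y) = f x + f y) (hg : ∀ x y, g (x * y) = g x + g y)
    (h : ∀ a, f (FreeGroup.of a) = g (FreeGroup.of a)) (x : FreeGroup (Fin n)) : f x = g x := by
  let F : FreeGroup (Fin n) →* Multiplicative M := MonoidHom.mk' (fun x => .ofAdd (f x)) (by
    intro a b; rw [hf]; rfl)
  let G : FreeGroup (Fin n) →* Multiplicative M := MonoidHom.mk' (fun x => .ofAdd (g x)) (by
    intro a b; rw [hg]; rfl)
  have : F = G := FreeGroup.ext_hom F G fun a => congrArg Multiplicative.ofAdd (h a)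
  exact congr(($this x).toAdd)

@[simp] theorem abMap_ab {n m : ℕ} (f : FreeGroup (Fin n) →* FreeGroup (Fin m))
    (x : FreeGroup (Fin n)) : abMap k f (ab k x) = ab k (f x) :=
  eq_of_additive (fun x => abMap k f (ab k x)) (fun x => ab k (f x)) (by simp) (by simp) (by simp) x

theorem abMap_comp {n m r : ℕ} (g : FreeGroup (Fin m) →* FreeGroup (Fin r))
    (f : FreeGroup (Fin n) →* FreeGroup (Fin m)) : abMap k (g.comp f) = abMap k g ∘ₗ abMap k f :=
  (Pi.basisFun k (Fin n)).ext fun a => by simp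

@[simp] theorem abMap_id (n : ℕ) : abMap k (MonoidHom.id (FreeGroup (Fin n))) = LinearMap.id :=
  (Pi.basisFun k (Fin n)).ext fun a => by simp

/-- The automorphism group of the free group on `n` letters (in universe `u`). -/
def AutF (n : ℕ) : Type u := ULift.{u} (MulAut (FreeGroup (Fin n)))

instance (n : ℕ) : Group (AutF.{u} n) :=
  inferInstanceAs (Group (ULift.{u} (MulAut (FreeGroup (Fin n)))))

/-- The underlying endomorphism of an automorphism. -/
abbrev AutF.hom {n : ℕ} (φ : AutF.{u} n) : FreeGroup (Fin n) →* FreeGroup (Fin n) :=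
  φ.down.toMonoidHom

theorem AutF.hom_mul {n : ℕ} (φ ψ : AutF.{u} n) : (φ * ψ).hom = φ.hom.comp ψ.hom := rfl

theorem AutF.hom_one {n : ℕ} : (1 : AutF.{u} n).hom = MonoidHom.id _ := rfl

/-- The action of the automorphism group on `(kⁿ)^{⊗ q}`. -/
def tRep (n q : ℕ) : Representation k (AutF.{u} n) (T k n q) where
  toFun φ := tmap q (abMap k φ.hom)
  map_one' := by rw [AutF.hom_one, abMap_id, tmap_id]; rfl
  map_mul' φ ψ := by rw [AutF.hom_mul, abMap_comp, tmap_comp]; rfl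

/-- The coefficients `B_{l,q} = Hom((kⁿ)^{⊗ l}, (kⁿ)^{⊗ q})` with the diagonal action. -/
abbrev coeff (n q l : ℕ) : Rep.{u} k (AutF.{u} n) :=
  Rep.of (X := T k n l →ₗ[k] T k n q) (Representation.linHom (tRep k n l) (tRep k n q))

/-- The inclusion of the first `n` letters. -/
def incl (n : ℕ) : FreeGroup (Fin n) →* FreeGroup (Fin (n + 1)) := FreeGroup.map Fin.castSucc

/-- The projection onto the first `n` letters, killing the last one. -/
def proj (n : ℕ) : FreeGroup (Fin (n + 1)) →* FreeGroup (Fin n) :=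
  FreeGroup.lift (Fin.lastCases 1 FreeGroup.of)

/-- The free product of an endomorphism with the identity of an infinite cyclic group. -/
def extend {n : ℕ} (f : FreeGroup (Fin n) →* FreeGroup (Fin n)) :
    FreeGroup (Fin (n + 1)) →* FreeGroup (Fin (n + 1)) :=
  FreeGroup.lift (Fin.lastCases (FreeGroup.of (Fin.last n)) fun a => incl n (f (FreeGroup.of a)))

theorem extend_incl {n : ℕ} (f : FreeGroup (Fin n) →* FreeGroup (Fin n)) :
    (extend f).comp (incl n) = (incl n).comp f :=
  FreeGroup.ext_hom _ _ fun a => by simp [extend, incl]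

theorem proj_incl (n : ℕ) : (proj n).comp (incl n) = MonoidHom.id _ :=
  FreeGroup.ext_hom _ _ fun a => by simp [proj, incl]

theorem proj_extend {n : ℕ} (f : FreeGroup (Fin n) →* FreeGroup (Fin n)) :
    (proj n).comp (extend f) = f.comp (proj n) :=
  FreeGroup.ext_hom _ _ fun a => by
    refine Fin.lastCases ?_ (fun a => ?_) a
    · simp [proj, extend]
    · have := congr($(proj_incl n) (f (FreeGroup.of a)))
      simp only [MonoidHom.comp_apply, MonoidHom.id_apply] at this
      simp [extend, this]
      simp [proj]

theorem extend_comp {n : ℕ} (f g : FreeGroup (Fin n) →* FreeGroup (Fin n)) :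
    extend (f.comp g) = (extend f).comp (extend g) :=
  FreeGroup.ext_hom _ _ fun a => by
    refine Fin.lastCases ?_ (fun a => ?_) a
    · simp [extend]
    · have := congr($(extend_incl f) (g (FreeGroup.of a)))
      simp only [MonoidHom.comp_apply] at this
      rw [MonoidHom.comp_apply, show extend g (FreeGroup.of a.castSucc) =
        incl n (g (FreeGroup.of a)) by simp [extend], this]
      simp [extend]

theorem extend_id (n : ℕ) : extend (MonoidHom.id (FreeGroup (Fin n))) = MonoidHom.id _ :=
  FreeGroup.ext_hom _ _ fun a => by
    refine Fin.lastCases ?_ (fun a => ?_) a <;> simp [extend, incl]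

/-- The stabilization homomorphism `φ ↦ φ * ℤ`. -/
def stab (n : ℕ) : AutF.{u} n →* AutF.{u} (n + 1) where
  toFun φ := ULift.up <| MonoidHom.toMulEquiv (extend φ.hom) (extend φ⁻¹.hom)
    (by rw [← extend_comp, ← AutF.hom_mul, inv_mul_cancel, AutF.hom_one, extend_id])
    (by rw [← extend_comp, ← AutF.hom_mul, mul_inv_cancel, AutF.hom_one, extend_id])
  map_one' := by
    refine congrArg ULift.up (MulEquiv.ext fun x => ?_)
    exact congr($(extend_id n) x)
  map_mul' φ ψ := by
    refine congrArg ULift.up (MulEquiv.ext fun x => ?_)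
    exact congr($(extend_comp φ.hom ψ.hom) x)

theorem stab_hom {n : ℕ} (φ : AutF.{u} n) : (stab n φ).hom = extend φ.hom := rfl

variable {k} in
/-- A linear map commuting with the actions of a group, as a morphism of representations. -/
def mkHom {G : Type u} [Group G] {A B : Rep.{u} k G} (f : A →ₗ[k] B)
    (hf : ∀ g a, f (A.ρ g a) = B.ρ g (f a)) : A ⟶ B :=
  Rep.ofHom ⟨f, fun g => LinearMap.ext (hf g)⟩

variable {k} in
/-- The map `F ↦ a ∘ F ∘ b`. -/
def sandwich {L Q L' Q' : Type*} [AddCommMonoid L] [AddCommMonoid Q] [AddCommMonoid L']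
    [AddCommMonoid Q'] [Module k L] [Module k Q] [Module k L'] [Module k Q'] (a : Q →ₗ[k] Q')
    (b : L' →ₗ[k] L) : (L →ₗ[k] Q) →ₗ[k] (L' →ₗ[k] Q') where
  toFun F := a ∘ₗ F ∘ₗ b
  map_add' F F' := by rw [LinearMap.add_comp, LinearMap.comp_add]
  map_smul' c F := by rw [LinearMap.smul_comp, LinearMap.comp_smul]; rfl

/-- The compression `F ↦ p^{⊗ q} ∘ F ∘ i^{⊗ l}` from level `n + 1` to level `n`. -/
def compress (n q l : ℕ) : Rep.res (stab n) (coeff k (n + 1) q l) ⟶ coeff k n q l :=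
  mkHom (A := Rep.res (stab n) (coeff k (n + 1) q l)) (B := coeff k n q l)
    (sandwich (tmap q (abMap k (proj n))) (tmap l (abMap k (incl n))))
    fun φ F => by
      have h1 : tmap q (abMap k (proj n)) ∘ₗ tmap q (abMap k (stab n φ).hom) =
          tmap q (abMap k φ.hom) ∘ₗ tmap q (abMap k (proj n)) := by
        rw [← tmap_comp, ← tmap_comp, ← abMap_comp, ← abMap_comp, stab_hom, proj_extend]
      have h2 : tmap l (abMap k (stab n φ⁻¹).hom) ∘ₗ tmap l (abMap k (incl n)) =
          tmap l (abMap k (incl n)) ∘ₗ tmap l (abMap k φ⁻¹.hom) := by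
        rw [← tmap_comp, ← tmap_comp, ← abMap_comp, ← abMap_comp, stab_hom, extend_incl]
      exact congr($h1 ∘ₗ (F : T k (n + 1) l →ₗ[k] T k (n + 1) q) ∘ₗ
        tmap l (abMap k (stab n φ⁻¹).hom) ∘ₗ tmap l (abMap k (incl n))).trans <|
        congr((tmap q (abMap k φ.hom) ∘ₗ tmap q (abMap k (proj n))) ∘ₗ
          (F : T k (n + 1) l →ₗ[k] T k (n + 1) q) ∘ₗ $h2)

end FreeGroups

end StableAut

namespace StableAut

open groupCohomology

section Magnus

variable (k : Type u) [CommRing k]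

/-- A Magnus expansion of the free group `F` on `n` letters: a group homomorphism `θ` from `F` to
the units of the completed tensor algebra `∏ₘ (kⁿ)^{⊗ m}` with `θ(γ) = 1 + [γ] + ⋯`. It is given
by its homogeneous components `θₘ`; the product of the completed tensor algebra is the Cauchy
product of sequences, written here inside the tensor algebra, into which every tensor power
embeds. -/
structure MagnusExpansion (n : ℕ) where
  /-- The homogeneous components. -/
  comp (m : ℕ) : FreeGroup (Fin n) → T k n m
  comp_zero (γ : FreeGroup (Fin n)) : TensorPower.toTensorAlgebra (comp 0 γ) = 1
  comp_one (γ : FreeGroup (Fin n)) :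
    TensorPower.toTensorAlgebra (comp 1 γ) = TensorAlgebra.ι k (ab k γ)
  comp_mul (m : ℕ) (γ δ : FreeGroup (Fin n)) :
    TensorPower.toTensorAlgebra (comp m (γ * δ)) = ∑ s ∈ Finset.HasAntidiagonal.antidiagonal m,
      TensorPower.toTensorAlgebra (comp s.1 γ) * TensorPower.toTensorAlgebra (comp s.2 δ)

variable {k}

theorem toTensorAlgebra_injective (n m : ℕ) :
    Function.Injective (TensorPower.toTensorAlgebra : T k n m →ₗ[k] TensorAlgebra k (Fin n → k)) := by
  intro x y h
  have hx (z : T k n m) : TensorAlgebra.toDirectSum (TensorPower.toTensorAlgebra z) =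
      DirectSum.of (fun m => T k n m) m z := by
    rw [← TensorAlgebra.toDirectSum_ofDirectSum (DirectSum.of (fun m => T k n m) m z)]
    congr 1
    exact (DirectSum.toAddMonoid_of
      (fun _ ↦ LinearMap.toAddMonoidHom TensorPower.toTensorAlgebra) m z).symm
  exact DirectSum.of_injective m ((hx x).symm.trans ((congrArg _ h).trans (hx y)))

theorem MagnusExpansion.comp_two {n : ℕ} (θ : MagnusExpansion k n) (γ δ : FreeGroup (Fin n)) :
    θ.comp 2 (γ * δ) =
      θ.comp 2 γ + θ.comp 2 δ + PiTensorProduct.tprod k ![ab k γ, ab k δ] := by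
  apply toTensorAlgebra_injective
  rw [θ.comp_mul, map_add, map_add, TensorPower.toTensorAlgebra_tprod,
    show Finset.HasAntidiagonal.antidiagonal 2 = {(0, 2), (1, 1), (2, 0)} from rfl]
  rw [Finset.sum_insert (by decide), Finset.sum_insert (by decide), Finset.sum_singleton]
  simp only [θ.comp_zero, θ.comp_one, TensorAlgebra.tprod_apply]
  simp
  abel

/-- The value `θ₂(γ) - φ^{⊗ 2} θ₂(φ⁻¹(γ))` of the first Johnson map. -/
def johnsonAux {n : ℕ} (θ : MagnusExpansion k n) (φ : AutF.{u} n) (γ : FreeGroup (Fin n)) :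
    T k n 2 :=
  θ.comp 2 γ - tmap 2 (abMap k φ.hom) (θ.comp 2 (φ⁻¹.hom γ))

/-- The first Johnson map `τ₁ : Aut(F) → Hom(kⁿ, (kⁿ)^{⊗ 2})` of a Magnus expansion `θ`: with
`τ(φ)` the filtered automorphism of the completed tensor algebra such that
`τ(φ) ∘ |φ| ∘ θ = θ ∘ φ`, `τ₁(φ)` is the degree two component of `τ(φ)` on `kⁿ`. Comparing the
components of degree two at `φ⁻¹(γ)` gives `τ₁(φ)[γ] = θ₂(γ) - |φ|^{⊗ 2} θ₂(φ⁻¹(γ))`; see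
`johnson_ab`. -/
def johnson {n : ℕ} (θ : MagnusExpansion k n) (φ : AutF.{u} n) : T k n 1 →ₗ[k] T k n 2 :=
  (Pi.basisFun k (Fin n)).constr k (fun a => johnsonAux θ φ (FreeGroup.of a)) ∘ₗ
    (PiTensorProduct.subsingletonEquiv (0 : Fin 1)).toLinearMap

theorem tmap_two {n : ℕ} (g : (Fin n → k) →ₗ[k] (Fin n → k)) (x y : Fin n → k) :
    tmap 2 g (PiTensorProduct.tprod k ![x, y]) = PiTensorProduct.tprod k ![g x, g y] := by
  rw [tmap_tprod]
  congr 1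
  funext s
  fin_cases s <;> rfl

theorem johnsonAux_mul {n : ℕ} (θ : MagnusExpansion k n) (φ : AutF.{u} n)
    (γ δ : FreeGroup (Fin n)) :
    johnsonAux θ φ (γ * δ) = johnsonAux θ φ γ + johnsonAux θ φ δ := by
  have h (x : FreeGroup (Fin n)) : φ.hom (φ⁻¹.hom x) = x := by
    have := AutF.hom_mul φ φ⁻¹
    rw [mul_inv_cancel, AutF.hom_one] at this
    exact congr($this.symm x)
  simp only [johnsonAux, map_mul, θ.comp_two, map_add, tmap_two, abMap_ab, h]
  abel

theorem johnson_ab {n : ℕ} (θ : MagnusExpansion k n) (φ : AutF.{u} n) (γ : FreeGroup (Fin n)) :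
    johnson θ φ (PiTensorProduct.tprod k fun _ => ab k γ) = johnsonAux θ φ γ := by
  have h0 (γ : FreeGroup (Fin n)) : johnson θ φ (PiTensorProduct.tprod k fun _ => ab k γ) =
      (Pi.basisFun k (Fin n)).constr k (fun a => johnsonAux θ φ (FreeGroup.of a)) (ab k γ) := by
    simp only [johnson, LinearMap.comp_apply, LinearEquiv.coe_coe]
    rw [PiTensorProduct.subsingletonEquiv_apply_tprod]
  rw [h0]
  refine eq_of_additive
    (fun γ => (Pi.basisFun k (Fin n)).constr k (fun a => johnsonAux θ φ (FreeGroup.of a)) (ab k γ))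
    (johnsonAux θ φ) (fun x y => by rw [ab_mul, map_add]) (johnsonAux_mul θ φ) (fun a => ?_) γ
  simp only [ab_of]
  rw [← Pi.basisFun_apply, Module.Basis.constr_basis]

theorem johnson_mul {n : ℕ} (θ : MagnusExpansion k n) (φ ψ : AutF.{u} n) :
    johnson θ (φ * ψ) = (coeff k n 2 1).ρ φ (johnson θ ψ) + johnson θ φ := by
  refine LinearMap.ext fun t => ?_
  obtain ⟨x, rfl⟩ := (PiTensorProduct.subsingletonEquiv (R := k) (s := fun _ => Fin n → k)
    (0 : Fin 1)).symm.surjective t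
  rw [PiTensorProduct.subsingletonEquiv_symm_apply']
  let L (f : T k n 1 →ₗ[k] T k n 2) : (Fin n → k) →ₗ[k] T k n 2 :=
    f ∘ₗ (PiTensorProduct.subsingletonEquiv (R := k) (s := fun _ => Fin n → k)
      (0 : Fin 1)).symm.toLinearMap
  have hL (f : T k n 1 →ₗ[k] T k n 2) (x : Fin n → k) :
      L f x = f (PiTensorProduct.tprod k fun _ => x) := by
    simp only [L, LinearMap.comp_apply, LinearEquiv.coe_coe]
    rw [PiTensorProduct.subsingletonEquiv_symm_apply']
  rw [← hL, ← hL]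
  congr 1
  refine (Pi.basisFun k (Fin n)).ext fun a => ?_
  rw [hL, hL, Pi.basisFun_apply, ← ab_of, johnson_ab]
  change _ = tmap 2 (abMap k φ.hom) (johnson θ ψ (tmap 1 (abMap k φ⁻¹.hom)
    (PiTensorProduct.tprod k fun _ => ab k (FreeGroup.of a)))) +
    johnson θ φ (PiTensorProduct.tprod k fun _ => ab k (FreeGroup.of a))
  rw [tmap_tprod, abMap_ab, johnson_ab, johnson_ab]
  simp only [johnsonAux, map_sub, mul_inv_rev, AutF.hom_mul, abMap_comp, tmap_comp,
    MonoidHom.comp_apply, LinearMap.comp_apply]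
  abel

/-- The class `h₁ = [τ₁] ∈ H¹(Aut(F); Hom(kⁿ, (kⁿ)^{⊗ 2}))`. -/
def johnsonClass {n : ℕ} (θ : MagnusExpansion k n) : groupCohomology (coeff k n 2 1) 1 :=
  H1π (coeff k n 2 1) ⟨johnson θ, (mem_cocycles₁_iff _).2 (johnson_mul θ)⟩

end Magnus

section Level

variable {k : Type u} [CommRing k]

theorem coeff_ρ {n q l : ℕ} (φ : AutF.{u} n) (F : T k n l →ₗ[k] T k n q) :
    (coeff k n q l).ρ φ F = tmap q (abMap k φ.hom) ∘ₗ F ∘ₗ tmap l (abMap k φ⁻¹.hom) := rfl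

theorem tmap_inv_hom {n : ℕ} (φ : AutF.{u} n) (l : ℕ) :
    tmap l (abMap k φ⁻¹.hom) ∘ₗ tmap l (abMap k φ.hom) = LinearMap.id := by
  rw [← tmap_comp, ← abMap_comp, ← AutF.hom_mul, inv_mul_cancel, AutF.hom_one, abMap_id, tmap_id]

theorem tmap_hom_inv {n : ℕ} (φ : AutF.{u} n) (l : ℕ) :
    tmap l (abMap k φ.hom) ∘ₗ tmap l (abMap k φ⁻¹.hom) = LinearMap.id := by
  rw [← tmap_comp, ← abMap_comp, ← AutF.hom_mul, mul_inv_cancel, AutF.hom_one, abMap_id, tmap_id]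

/-- The linear map sending the formal tensor `f ⊗ g` to the tensor product of the maps. -/
def tensLin (n n' q₁ l₁ q₂ l₂ : ℕ) :
    (T k n l₁ →ₗ[k] T k n' q₁) ⊗[k] (T k n l₂ →ₗ[k] T k n' q₂) →ₗ[k]
      (T k n (l₁ + l₂) →ₗ[k] T k n' (q₁ + q₂)) :=
  sandwich TensorPower.mulEquiv.toLinearMap TensorPower.mulEquiv.symm.toLinearMap ∘ₗ
    TensorProduct.homTensorHomMap (RingHom.id k) _ _ _ _

@[simp] theorem tensLin_tmul {n n' q₁ l₁ q₂ l₂ : ℕ} (f : T k n l₁ →ₗ[k] T k n' q₁)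
    (g : T k n l₂ →ₗ[k] T k n' q₂) : tensLin n n' q₁ l₁ q₂ l₂ (f ⊗ₜ[k] g) = tens f g := rfl

/-- The equivariant map `λ : Hom(M₁, M₂) ⊗ Hom(N₁, N₂) → Hom(M₁ ⊗ N₁, M₂ ⊗ N₂)`. -/
def tensHom (n q₁ l₁ q₂ l₂ : ℕ) :
    coeff k n q₁ l₁ ⊗ coeff k n q₂ l₂ ⟶ coeff k n (q₁ + q₂) (l₁ + l₂) :=
  mkHom (A := coeff k n q₁ l₁ ⊗ coeff k n q₂ l₂) (tensLin n n q₁ l₁ q₂ l₂) fun φ x => by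
    induction x using TensorProduct.induction_on with
    | zero => simp
    | add x y hx hy => rw [map_add, map_add, hx, hy, map_add, map_add]
    | tmul f g =>
      change tens (tmap q₁ (abMap k φ.hom) ∘ₗ f ∘ₗ tmap l₁ (abMap k φ⁻¹.hom))
        (tmap q₂ (abMap k φ.hom) ∘ₗ g ∘ₗ tmap l₂ (abMap k φ⁻¹.hom)) =
        tmap (q₁ + q₂) (abMap k φ.hom) ∘ₗ tens f g ∘ₗ tmap (l₁ + l₂) (abMap k φ⁻¹.hom)
      rw [tens_comp, tens_comp, tmap_add, tmap_add]

/-- The equivariant composition map `f ⊗ g ↦ f ∘ g`. -/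
def compHom (n q l m : ℕ) : coeff k n q l ⊗ coeff k n l m ⟶ coeff k n q m :=
  mkHom (A := coeff k n q l ⊗ coeff k n l m)
    (TensorProduct.lift (LinearMap.llcomp k (T k n m) (T k n l) (T k n q))) fun φ x => by
    induction x using TensorProduct.induction_on with
    | zero => simp
    | add x y hx hy => rw [map_add, map_add, hx, hy, map_add, map_add]
    | tmul f g =>
      have := congr(((tmap q (abMap k φ.hom) ∘ₗ (f : T k n l →ₗ[k] T k n q)) ∘ₗ
        $(tmap_inv_hom φ l)) ∘ₗ (g : T k n m →ₗ[k] T k n l) ∘ₗ tmap m (abMap k φ⁻¹.hom))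
      exact this

/-- The equivariant composition map `γ : f ⊗ g ↦ g ∘ f`. -/
def gammaHom (n q l m : ℕ) : coeff k n l m ⊗ coeff k n q l ⟶ coeff k n q m :=
  mkHom (A := coeff k n l m ⊗ coeff k n q l)
    (TensorProduct.lift (LinearMap.llcomp k (T k n m) (T k n l) (T k n q)).flip) fun φ x => by
    induction x using TensorProduct.induction_on with
    | zero => simp
    | add x y hx hy => rw [map_add, map_add, hx, hy, map_add, map_add]
    | tmul g f =>
      have := congr(((tmap q (abMap k φ.hom) ∘ₗ (f : T k n l →ₗ[k] T k n q)) ∘ₗ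
        $(tmap_inv_hom φ l)) ∘ₗ (g : T k n m →ₗ[k] T k n l) ∘ₗ tmap m (abMap k φ⁻¹.hom))
      exact this

/-- The contraction `φⁱⱼ` as an equivariant map. -/
def contractionHom (n : ℕ) {q l : ℕ} (i : Fin (q + 1)) (j : Fin (l + 1)) :
    coeff k n (q + 1) (l + 1) ⟶ coeff k n q l :=
  mkHom (contraction n i j) fun φ F =>
    contraction_equivariant i j _ _ (by
      rw [← abMap_comp, ← AutF.hom_mul, inv_mul_cancel, AutF.hom_one, abMap_id]) F

/-- The actions of `σ` and `τ` by permuting the output and the input tensor factors. -/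
def permHom (n : ℕ) {q l : ℕ} (σ : Equiv.Perm (Fin q)) (τ : Equiv.Perm (Fin l)) :
    coeff k n q l ⟶ coeff k n q l :=
  mkHom (sandwich (PiTensorProduct.reindex k (fun _ : Fin q => Fin n → k) σ).toLinearMap
    (PiTensorProduct.reindex k (fun _ : Fin l => Fin n → k) τ).toLinearMap) fun φ F => by
    refine LinearMap.ext fun t => ?_
    change PiTensorProduct.reindex k (fun _ => Fin n → k) σ (tmap q (abMap k φ.hom) (F
      (tmap l (abMap k φ⁻¹.hom) (PiTensorProduct.reindex k (fun _ => Fin n → k) τ t)))) =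
      tmap q (abMap k φ.hom) (PiTensorProduct.reindex k (fun _ => Fin n → k) σ (F
        (PiTensorProduct.reindex k (fun _ => Fin n → k) τ (tmap l (abMap k φ⁻¹.hom) t))))
    have h1 := fun t => PiTensorProduct.map_reindex (R := k) (fun _ : Fin q => abMap k φ.hom) σ t
    have h2 := fun t => PiTensorProduct.map_reindex (R := k) (fun _ : Fin l => abMap k φ⁻¹.hom) τ t
    simp only [tmap] at h1 h2 ⊢
    rw [h1, h2]

/-- The class of the identity of `(kⁿ)^{⊗ q}`. -/
def idClass (n q : ℕ) : groupCohomology (coeff k n q q) 0 :=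
  invClass (LinearMap.id : T k n q →ₗ[k] T k n q) fun φ => by
    rw [coeff_ρ, LinearMap.id_comp, tmap_hom_inv]

/-- The tensor product of cohomology classes: the cup product followed by `λ`. -/
def hcompLevel {n q₁ l₁ q₂ l₂ i j m : ℕ} (h : i + j = m) (x : groupCohomology (coeff k n q₁ l₁) i)
    (y : groupCohomology (coeff k n q₂ l₂) j) :
    groupCohomology (coeff k n (q₁ + q₂) (l₁ + l₂)) m :=
  coh (tensHom n q₁ l₁ q₂ l₂) m (cup h x y)

/-- The composition `x ∘ y` of `x ∈ Hⁱ(Hom(V^{⊗ m}, V^{⊗ l}))` and `y ∈ Hʲ(Hom(V^{⊗ l}, V^{⊗ q}))`: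
the cup product `x ∪ y` followed by `γ : f ⊗ g ↦ g ∘ f`. -/
def vcompLevel {n q l m i j d : ℕ} (h : i + j = d) (x : groupCohomology (coeff k n l m) i)
    (y : groupCohomology (coeff k n q l) j) : groupCohomology (coeff k n q m) d :=
  coh (gammaHom n q l m) d (cup h x y)

end Level

end StableAut

namespace StableAut

open groupCohomology

section Kawazumi

variable {k : Type u} [CommRing k]

/-- The tensor powers `A^{⊗ p}` of a representation. -/
def tpow {G : Type u} [Group G] (A : Rep.{u} k G) : ℕ → Rep.{u} k G
  | 0 => 𝟙_ (Rep.{u} k G)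
  | p + 1 => tpow A p ⊗ A

/-- The cup powers `x^{∪ p} ∈ Hᵖ(G; A^{⊗ p})` of a class `x ∈ H¹(G; A)`. -/
def cupPow {G : Type u} [Group G] {A : Rep.{u} k G} (x : groupCohomology A 1) :
    (p : ℕ) → groupCohomology (tpow A p) p
  | 0 => invClass (A := 𝟙_ (Rep.{u} k G)) (1 : k) fun _ => rfl
  | p + 1 => cup rfl (cupPow x p) x

theorem tmap_cast {n m a b : ℕ} (h : a = b) (g : (Fin n → k) →ₗ[k] (Fin m → k)) :
    tmap b g ∘ₗ (TensorPower.cast k (Fin n → k) h).toLinearMap =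
      (TensorPower.cast k (Fin m → k) h).toLinearMap ∘ₗ tmap a g := by
  subst h
  simp [TensorPower.cast_refl, LinearMap.id_comp, LinearMap.comp_id]

/-- The map `u ↦ u ⊗ 1` from `Hom(V, V^{⊗ 2})` to `Hom(V^{⊗ (r + 1)}, V^{⊗ (r + 2)})`, where
`V = kⁿ` and `1` is the identity of `V^{⊗ r}`. -/
def tensOne (n r : ℕ) : coeff k n 2 1 ⟶ coeff k n (r + 2) (r + 1) :=
  mkHom (sandwich (TensorPower.cast k (Fin n → k) (add_comm 2 r)).toLinearMap
      (TensorPower.cast k (Fin n → k) (add_comm r 1)).toLinearMap ∘ₗ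
      tensLin n n 2 1 r r ∘ₗ (TensorProduct.mk k (T k n 1 →ₗ[k] T k n 2)
        (T k n r →ₗ[k] T k n r)).flip LinearMap.id) fun φ u => by
    have h1 : tens (tmap 2 (abMap k φ.hom) ∘ₗ (u : T k n 1 →ₗ[k] T k n 2) ∘ₗ
        tmap 1 (abMap k φ⁻¹.hom)) (LinearMap.id : T k n r →ₗ[k] T k n r) =
        tmap (2 + r) (abMap k φ.hom) ∘ₗ tens (u : T k n 1 →ₗ[k] T k n 2) LinearMap.id ∘ₗ
          tmap (1 + r) (abMap k φ⁻¹.hom) := by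
      rw [tmap_add, tmap_add, ← tens_comp, ← tens_comp, LinearMap.id_comp, tmap_hom_inv]
    refine LinearMap.ext fun t => ?_
    change TensorPower.cast k (Fin n → k) (add_comm 2 r) (tens (tmap 2 (abMap k φ.hom) ∘ₗ
      (u : T k n 1 →ₗ[k] T k n 2) ∘ₗ tmap 1 (abMap k φ⁻¹.hom)) LinearMap.id
      (TensorPower.cast k (Fin n → k) (add_comm r 1) t)) =
      tmap (r + 2) (abMap k φ.hom) (TensorPower.cast k (Fin n → k) (add_comm 2 r)
        (tens (u : T k n 1 →ₗ[k] T k n 2) LinearMap.id (TensorPower.cast k (Fin n → k)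
          (add_comm r 1) (tmap (r + 1) (abMap k φ⁻¹.hom) t))))
    rw [h1]
    have h2 := fun t => congr($(tmap_cast (k := k) (add_comm r 1) (abMap k φ⁻¹.hom)) t)
    have h3 := fun t => congr($(tmap_cast (k := k) (add_comm 2 r) (abMap k φ.hom)) t)
    simp only [LinearMap.comp_apply, LinearEquiv.coe_coe] at h2 h3 ⊢
    rw [h2, h3]

/-- The map `u₁ ⊗ ⋯ ⊗ u_p ↦ (u₁ ⊗ 1_{r+p-1}) ∘ (u₂ ⊗ 1_{r+p-2}) ∘ ⋯ ∘ (u_p ⊗ 1_r)` from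
`Hom(V, V^{⊗ 2})^{⊗ p}` to `Hom(V^{⊗ (r + 1)}, V^{⊗ (p + r + 1)})`, where `1_s` is the identity of
`V^{⊗ s}` and `N = p + r + 1`. -/
def iterComp (n N : ℕ) : (p r : ℕ) → p + r + 1 = N → (tpow (coeff k n 2 1) p ⟶ coeff k n N (r + 1))
  | 0, r, h => mkHom (A := 𝟙_ (Rep.{u} k (AutF.{u} n)))
      (LinearMap.toSpanSingleton k (T k n (r + 1) →ₗ[k] T k n N)
        (TensorPower.cast k (Fin n → k) (show r + 1 = N by omega)).toLinearMap) fun φ c => by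
      change c • (TensorPower.cast k (Fin n → k) (show r + 1 = N by omega)).toLinearMap =
        (coeff k n N (r + 1)).ρ φ
          (c • (TensorPower.cast k (Fin n → k) (show r + 1 = N by omega)).toLinearMap)
      rw [map_smul, coeff_ρ, ← LinearMap.comp_assoc, tmap_cast, LinearMap.comp_assoc,
        tmap_hom_inv, LinearMap.comp_id]
  | p + 1, r, h => (iterComp n N p (r + 1) (by omega) ⊗ₘ tensOne n r) ≫ compHom n N (r + 2) (r + 1)

/-- The map `ς_p : u₁ ⊗ ⋯ ⊗ u_p ↦ (u₁ ⊗ 1_{p-1}) ∘ (u₂ ⊗ 1_{p-2}) ∘ ⋯ ∘ (u_{p-1} ⊗ 1_1) ∘ u_p`. -/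
def varsigma (n p : ℕ) : tpow (coeff k n 2 1) p ⟶ coeff k n (p + 1) 1 :=
  iterComp n (p + 1) p 0 rfl

/-- Kawazumi's class `h_p = ς_p(h₁^{∪ p}) ∈ Hᵖ(Aut(F); Hom(kⁿ, (kⁿ)^{⊗ (p + 1)}))`. -/
def kawazumiClass {n : ℕ} (θ : MagnusExpansion k n) (p : ℕ) :
    groupCohomology (coeff k n (p + 1) 1) p :=
  coh (varsigma n p) p (cupPow (johnsonClass θ) p)

/-- Kawazumi's reduced class `φ¹₁(h_p) ∈ Hᵖ(Aut(F); (kⁿ)^{⊗ p})`, obtained by contracting the input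
with the first output. -/
def reducedKawazumiClass {n : ℕ} (θ : MagnusExpansion k n) (p : ℕ) :
    groupCohomology (coeff k n p 0) p :=
  coh (contractionHom n 0 0) p (kawazumiClass θ p)

end Kawazumi

section Stable

variable {k : Type u} [CommRing k]

/-- The stabilization map `αₙ`. -/
def alpha (n q l i : ℕ) :
    groupCohomology (coeff k (n + 1) q l) i →ₗ[k] groupCohomology (coeff k n q l) i :=
  (map (stab n) (compress k n q l) i).hom

variable (k) in
/-- The stable cohomology `𝓗(q, l)ⁱ = limₙ Hⁱ(Aut(F_n); Hom((kⁿ)^{⊗ l}, (kⁿ)^{⊗ q}))`. -/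
def StableCoh (q l i : ℕ) : Submodule k (∀ n, groupCohomology (coeff k n q l) i) where
  carrier := {x | ∀ n, alpha n q l i (x (n + 1)) = x n}
  add_mem' hx hy n := by rw [Pi.add_apply, map_add, hx, hy]; rfl
  zero_mem' n := map_zero _
  smul_mem' c x hx n := by rw [Pi.smul_apply, map_smul, hx]; rfl

namespace StableCoh

/-- A stable class is determined by its components at all large `n`. -/
theorem eq_of_eventually {q l i : ℕ} {x y : StableCoh k q l i}
    (h : ∀ᶠ n in Filter.atTop, x.1 n = y.1 n) : x = y := by
  obtain ⟨N, hN⟩ := Filter.eventually_atTop.1 h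
  refine Subtype.ext (funext fun n => ?_)
  have : ∀ d n, N ≤ n + d → x.1 n = y.1 n := by
    intro d
    induction d with
    | zero => exact fun n hn => hN n hn
    | succ d ih => intro n hn; rw [← x.2 n, ← y.2 n, ih (n + 1) (by omega)]
  exact this N n (by omega)

variable (k) in
/-- The identity `1 ∈ 𝓗(q, q)⁰`. -/
def one (q : ℕ) : StableCoh k q q 0 := ⟨fun n => idClass n q, fun n => by
  refine map_invClass _ _ _ _ _ _ ?_
  change tmap q (abMap k (proj n)) ∘ₗ LinearMap.id ∘ₗ tmap q (abMap k (incl n)) = LinearMap.id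
  rw [LinearMap.id_comp, ← tmap_comp, ← abMap_comp, proj_incl, abMap_id, tmap_id]⟩

/-- The actions of the symmetric groups by place permutations. -/
def perm {q l i : ℕ} (σ : Equiv.Perm (Fin q)) (τ : Equiv.Perm (Fin l)) (x : StableCoh k q l i) :
    StableCoh k q l i :=
  ⟨fun n => coh (permHom n σ τ) i (x.1 n), fun n => by
    refine (map_coh (stab n) (compress k n q l) (compress k n q l) (permHom (n + 1) σ τ)
      (permHom n σ τ) (fun F => ?_) i (x.1 (n + 1))).trans (congrArg _ (x.2 n))
    refine LinearMap.ext fun t => ?_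
    have h1 := fun t => PiTensorProduct.map_reindex (R := k)
      (fun _ : Fin q => abMap k (proj n)) σ t
    have h2 := fun t => PiTensorProduct.map_reindex (R := k)
      (fun _ : Fin l => abMap k (incl n)) τ t
    change tmap q (abMap k (proj n)) (PiTensorProduct.reindex k (fun _ => Fin (n + 1) → k) σ (F
      (PiTensorProduct.reindex k (fun _ => Fin (n + 1) → k) τ (tmap l (abMap k (incl n)) t)))) =
      PiTensorProduct.reindex k (fun _ => Fin n → k) σ (tmap q (abMap k (proj n)) (F
        (tmap l (abMap k (incl n)) (PiTensorProduct.reindex k (fun _ => Fin n → k) τ t))))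
    simp only [tmap] at h1 h2 ⊢
    rw [h1, h2]⟩

def compress₂ (n q₁ l₁ q₂ l₂ : ℕ) :
    Rep.res (stab n) (coeff k (n + 1) q₁ l₁ ⊗ coeff k (n + 1) q₂ l₂) ⟶
      coeff k n q₁ l₁ ⊗ coeff k n q₂ l₂ :=
  mkHom (A := Rep.res (stab n) (coeff k (n + 1) q₁ l₁ ⊗ coeff k (n + 1) q₂ l₂))
    (B := coeff k n q₁ l₁ ⊗ coeff k n q₂ l₂)
    (TensorProduct.map (compress k n q₁ l₁).hom.toLinearMap (compress k n q₂ l₂).hom.toLinearMap)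
    fun φ x => by
      induction x using TensorProduct.induction_on with
      | zero => simp only [map_zero]
      | add x y hx hy => simp only [map_add, hx, hy]
      | tmul f g =>
        exact congrArg₂ (fun a b => a ⊗ₜ[k] b)
          (Rep.hom_comm_apply (compress k n q₁ l₁) φ f) (Rep.hom_comm_apply (compress k n q₂ l₂) φ g)

theorem compress_tens {n q₁ l₁ q₂ l₂ : ℕ} (f : T k (n + 1) l₁ →ₗ[k] T k (n + 1) q₁)
    (g : T k (n + 1) l₂ →ₗ[k] T k (n + 1) q₂) :
    tmap (q₁ + q₂) (abMap k (proj n)) ∘ₗ tens f g ∘ₗ tmap (l₁ + l₂) (abMap k (incl n)) =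
      tens (tmap q₁ (abMap k (proj n)) ∘ₗ f ∘ₗ tmap l₁ (abMap k (incl n)))
        (tmap q₂ (abMap k (proj n)) ∘ₗ g ∘ₗ tmap l₂ (abMap k (incl n))) := by
  rw [tens_comp, tens_comp, tmap_add, tmap_add]

theorem compress_tensHom (n : ℕ) {q₁ l₁ q₂ l₂ : ℕ}
    (F : (coeff k (n + 1) q₁ l₁ ⊗ coeff k (n + 1) q₂ l₂ : Rep.{u} k (AutF.{u} (n + 1)))) :
    (compress k n (q₁ + q₂) (l₁ + l₂)).hom ((tensHom (n + 1) q₁ l₁ q₂ l₂).hom F) =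
      (tensHom n q₁ l₁ q₂ l₂).hom ((compress₂ n q₁ l₁ q₂ l₂).hom F) := by
  have : sandwich (tmap (q₁ + q₂) (abMap k (proj n))) (tmap (l₁ + l₂) (abMap k (incl n))) ∘ₗ
      tensLin (n + 1) (n + 1) q₁ l₁ q₂ l₂ = tensLin n n q₁ l₁ q₂ l₂ ∘ₗ TensorProduct.map
        (sandwich (tmap q₁ (abMap k (proj n))) (tmap l₁ (abMap k (incl n))))
        (sandwich (tmap q₂ (abMap k (proj n))) (tmap l₂ (abMap k (incl n)))) :=
    TensorProduct.ext' fun f g => compress_tens f g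
  exact congr($this F)

/-- The horizontal composition `x ⊗ y` in `𝓗`. -/
def hcomp {q₁ l₁ q₂ l₂ i j m : ℕ} (h : i + j = m) (x : StableCoh k q₁ l₁ i)
    (y : StableCoh k q₂ l₂ j) : StableCoh k (q₁ + q₂) (l₁ + l₂) m :=
  ⟨fun n => hcompLevel h (x.1 n) (y.1 n), fun n => by
    refine (map_coh (stab n) (compress₂ n q₁ l₁ q₂ l₂) (compress k n (q₁ + q₂) (l₁ + l₂)) (tensHom (n + 1) q₁ l₁ q₂ l₂)
      (tensHom n q₁ l₁ q₂ l₂) (compress_tensHom n) m (cup h (x.1 (n + 1)) (y.1 (n + 1)))).trans ?_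
    refine congrArg (coh (tensHom n q₁ l₁ q₂ l₂) m) ?_
    refine (map_cup (stab n) (compress k n q₁ l₁) (compress k n q₂ l₂)
      (compress₂ n q₁ l₁ q₂ l₂) (fun _ _ => rfl) h
      (x.1 (n + 1)) (y.1 (n + 1))).trans ?_
    exact congrArg₂ _ (x.2 n) (y.2 n)⟩

/-- `z` is the vertical composition `x ∘ y` in `𝓗`, which is induced by the compositions at all
large levels `n`. By `eq_of_eventually` there is at most one such `z`. -/
def IsVComp {q l m i j d : ℕ} (h : i + j = d) (x : StableCoh k l m i) (y : StableCoh k q l j)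
    (z : StableCoh k q m d) : Prop :=
  ∀ᶠ n in Filter.atTop, z.1 n = vcompLevel h (x.1 n) (y.1 n)

/-- `y` is the contraction of `x` at the output `i` and the input `j`, which is induced by the
contractions `φ` at all large levels `n`. By `eq_of_eventually` there is at most one such `y`. -/
def IsContraction {q l d : ℕ} (i : Fin (q + 1)) (j : Fin (l + 1))
    (x : StableCoh k (q + 1) (l + 1) d) (y : StableCoh k q l d) : Prop :=
  ∀ᶠ n in Filter.atTop, y.1 n = coh (contractionHom n i j) d (x.1 n)

end StableCoh

variable (k) in
/-- A sub-wheeled PROP of `𝓗`: graded submodules containing the identities and closed under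
the symmetric groups, horizontal and vertical compositions and contractions (whenever the levelwise
contractions of a class form a stable class; those of the identity `1 ∈ 𝓗(1, 1)` are the integers
`n`, which do not). -/
structure SubWheeledPROP where
  carrier (q l i : ℕ) : Submodule k (StableCoh k q l i)
  one_mem (q : ℕ) : StableCoh.one k q ∈ carrier q q 0
  perm_mem {q l i : ℕ} (σ : Equiv.Perm (Fin q)) (τ : Equiv.Perm (Fin l)) {x : StableCoh k q l i} :
    x ∈ carrier q l i → StableCoh.perm σ τ x ∈ carrier q l i
  hcomp_mem {q₁ l₁ q₂ l₂ i j m : ℕ} (h : i + j = m) {x : StableCoh k q₁ l₁ i}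
    {y : StableCoh k q₂ l₂ j} : x ∈ carrier q₁ l₁ i → y ∈ carrier q₂ l₂ j →
      StableCoh.hcomp h x y ∈ carrier (q₁ + q₂) (l₁ + l₂) m
  vcomp_mem {q l m i j d : ℕ} (h : i + j = d) {x : StableCoh k l m i} {y : StableCoh k q l j}
    {z : StableCoh k q m d} : x ∈ carrier l m i → y ∈ carrier q l j → StableCoh.IsVComp h x y z →
      z ∈ carrier q m d
  contraction_mem {q l d : ℕ} (i : Fin (q + 1)) (j : Fin (l + 1))
    {x : StableCoh k (q + 1) (l + 1) d} {y : StableCoh k q l d} :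
    x ∈ carrier (q + 1) (l + 1) d → StableCoh.IsContraction i j x y → y ∈ carrier q l d

/-- The sub-wheeled PROP of `𝓗` generated by an element of `𝓗(2, 1)¹`. -/
def generated (h : StableCoh k 2 1 1) : SubWheeledPROP k where
  carrier q l i := ⨅ (S : SubWheeledPROP k) (_ : h ∈ S.carrier 2 1 1), S.carrier q l i
  one_mem q := by simp only [Submodule.mem_iInf]; exact fun S _ => S.one_mem q
  perm_mem σ τ x hx := by
    simp only [Submodule.mem_iInf] at hx ⊢; exact fun S hS => S.perm_mem σ τ (hx S hS)
  hcomp_mem h x y hx hy := by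
    simp only [Submodule.mem_iInf] at hx hy ⊢
    exact fun S hS => S.hcomp_mem h (hx S hS) (hy S hS)
  vcomp_mem h x y z hx hy hz := by
    simp only [Submodule.mem_iInf] at hx hy ⊢
    exact fun S hS => S.vcomp_mem h (hx S hS) (hy S hS) hz
  contraction_mem i j x y hx hy := by
    simp only [Submodule.mem_iInf] at hx ⊢
    exact fun S hS => S.contraction_mem i j (hx S hS) hy

end Stable

end StableAut

/-! Everything is reduced to identities between explicit inhomogeneous cochains: a class is handled
through any cocycle representing it (`IsRep`), and two classes agree once representatives agree
pointwise, possibly after adding a coboundary.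

Stability of `h_p`. The Magnus expansions at levels `n` and `n + 1` are unrelated, so the Johnson
cocycles do not restrict to each other on the nose. `exists_johnson_stab` repairs this with a
coboundary. It changes the degree two part of the expansion at level `n + 1` by a linear term, so
that it extends the one at level `n` and vanishes on the last letter. The new cocycle `t'` satisfies
`t'(φ * ℤ) ∘ i = i^{⊗ 2} ∘ τ₁(φ)` and kills the last basis vector. Intertwining with `i` passes
through the group action, through `u ↦ u ⊗ 1` and through composition, hence to all of `ς_p(t'^{∪
p})`. Composing with the projection and using `p ∘ i = 1` then gives `alpha_kawazumiClass`. For the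
contraction, the first `n` summands of the trace give the trace at level `n`, and the last one
vanishes because for `p ≥ 1` the cochain kills the last basis vector (`compress_contraction`,
`iterComp_cochainPow_last`).

The recursion. By associativity, `ς_{p+1}(w ⊗ u) = (ς_p(w) ⊗ 1) ∘ u` (`iterComp_tens`), so `h_{p+1}`
comes from the cup product `(h_p ⊗ 1) ∪ h₁`. The vertical composition `h₁ ∘ (h_p ⊗ 1)` uses the same
composite of maps but the cup product in the opposite order. Graded commutativity against a class of
degree one (`coh_cup_comm`) accounts for the sign `(-1)ᵖ`.

Membership in the generated sub-wheeled PROP then follows by induction on `p`, since `(-1)ᵖ` is a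
unit, and by one contraction for the reduced classes. -/

namespace StableAut

open groupCohomology

/-! ### Cocycle representatives and graded commutativity in degree one. -/

section Representatives

variable {k G H : Type u} [CommRing k] [Group G] [Group H]

/-- The cochain `c` is a cocycle of class `x`. -/
def IsRep {A : Rep.{u} k G} {i : ℕ} (c : (Fin i → G) → A) (x : groupCohomology A i) : Prop :=
  ∃ z : cocycles A i, (iCocycles A i z : (Fin i → G) → A) = c ∧ π A i z = x

theorem exists_isRep {A : Rep.{u} k G} {i : ℕ} (x : groupCohomology A i) :
    ∃ c : (Fin i → G) → A, IsRep c x := by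
  obtain ⟨z, hz⟩ := pi_surjective A i x
  exact ⟨_, z, rfl, hz⟩

/-- Since cocycles embed into cochains, equality of classes can be tested on values of
representatives. All later identities of classes are proved in this way. -/
theorem IsRep.eq {A : Rep.{u} k G} {i : ℕ} {c c' : (Fin i → G) → A} {x y : groupCohomology A i}
    (hx : IsRep c x) (hy : IsRep c' y) (h : ∀ g, c g = c' g) : x = y := by
  obtain ⟨z, hz, rfl⟩ := hx
  obtain ⟨w, hw, rfl⟩ := hy
  congr 1
  exact iCocycles_injective A i (hz.trans ((funext h).trans hw.symm))

theorem IsRep.d_eq_zero {A : Rep.{u} k G} {i : ℕ} {c : (Fin i → G) → A} {x : groupCohomology A i}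
    (hx : IsRep c x) : inhomogeneousCochains.d A i c = 0 := by
  obtain ⟨z, rfl, -⟩ := hx
  exact d_iCocycles z

theorem isRep_mk {A : Rep.{u} k G} {i : ℕ} (c : (Fin i → G) → A)
    (h : inhomogeneousCochains.d A i c = 0) : IsRep c (π A i (cocyclesMk c h)) :=
  ⟨_, iCocycles_mk _ _, rfl⟩

theorem IsRep.congr {A : Rep.{u} k G} {i : ℕ} {c c' : (Fin i → G) → A} {x : groupCohomology A i}
    (hx : IsRep c x) (h : ∀ g, c g = c' g) : IsRep c' x :=
  (funext h : c = c') ▸ hx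

theorem IsRep.smul {A : Rep.{u} k G} {i : ℕ} {c : (Fin i → G) → A} {x : groupCohomology A i}
    (r : k) (hx : IsRep c x) : IsRep (r • c) (r • x) := by
  obtain ⟨z, rfl, rfl⟩ := hx
  exact ⟨r • z, by rw [map_smul], by rw [map_smul]⟩

/-- Cocycles that differ by a coboundary have the same class. -/
theorem IsRep.add_d {A : Rep.{u} k G} {i : ℕ} {c : (Fin (i + 1) → G) → A}
    {x : groupCohomology A (i + 1)} (hx : IsRep c x) (b : (Fin i → G) → A) :
    IsRep (c + (inhomogeneousCochains.d A i b : (Fin (i + 1) → G) → A)) x := by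
  obtain ⟨z, rfl, rfl⟩ := hx
  have hd : inhomogeneousCochains.d A (i + 1)
      (inhomogeneousCochains.d A i b : (Fin (i + 1) → G) → A) = 0 :=
    congr($(inhomogeneousCochains.d_comp_d i A).hom b)
  obtain ⟨w, hw, -⟩ := isRep_mk _ hd
  refine ⟨z + w, by rw [map_add, hw], ?_⟩
  rw [map_add, (pi_succ_eq_zero_iff w).2 ⟨b, hw.symm⟩, add_zero]

theorem IsRep.cup {A B : Rep.{u} k G} {i j m : ℕ} (h : i + j = m) {a : (Fin i → G) → A}
    {b : (Fin j → G) → B} {x : groupCohomology A i} {y : groupCohomology B j}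
    (hx : IsRep a x) (hy : IsRep b y) : IsRep (cupCochain h a b) (cup h x y) := by
  obtain ⟨z, rfl, rfl⟩ := hx
  obtain ⟨w, rfl, rfl⟩ := hy
  exact ⟨_, iCocycles_cupCocycle h z w, (cup_pi h z w).symm⟩

theorem IsRep.map {A : Rep.{u} k H} {B : Rep.{u} k G} (f : G →* H) (φ : Rep.res f A ⟶ B) {i : ℕ}
    {a : (Fin i → H) → A} {x : groupCohomology A i} (hx : IsRep a x) :
    IsRep (fun g => φ.hom (a (f ∘ g))) (map f φ i x) := by
  obtain ⟨z, rfl, rfl⟩ := hx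
  exact ⟨_, funext fun g => iCocycles_cocyclesMap f φ i z g, (map_pi f φ i z).symm⟩

theorem IsRep.coh {A B : Rep.{u} k G} (f : A ⟶ B) {i : ℕ} {a : (Fin i → G) → A}
    {x : groupCohomology A i} (hx : IsRep a x) : IsRep (fun g => f.hom (a g)) (coh f i x) :=
  IsRep.map (A := A) (MonoidHom.id G) f hx

theorem isRep_invClass {A : Rep.{u} k G} (v : A) (hv : ∀ g, A.ρ g v = v) :
    IsRep (fun _ => v) (invClass v hv) :=
  ⟨_, iCocycles_mk _ _, rfl⟩

/-- The cup product with a class of degree one is graded commutative. -/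
theorem coh_cup_comm {A B C : Rep.{u} k G} {p : ℕ} (F : A ⊗ B ⟶ C) (F' : B ⊗ A ⟶ C)
    (hF : ∀ (a : A) (b : B), F.hom (a ⊗ₜ[k] b) = F'.hom (b ⊗ₜ[k] a))
    (x : groupCohomology A 1) (y : groupCohomology B p) :
    coh F (p + 1) (cup (add_comm 1 p) x y) = (-1 : k) ^ p • coh F' (p + 1) (cup rfl y x) := by
  obtain ⟨a, ha⟩ := exists_isRep x
  obtain ⟨b, hb⟩ := exists_isRep y
  have hl := (ha.cup (add_comm 1 p) hb).coh F
  have hr := ((hb.cup rfl ha).coh F').smul ((-1 : k) ^ p)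
  -- The homotopy between the two orders: with `P` the product of all arguments, `H = F'(b ⊗ a(P))`.
  -- The claim is that `a ∪ b + dH = (-1)ᵖ (b ∪ a)` already holds for cochains, after applying `F`
  -- and `F'`.
  let H : (Fin p → G) → C := fun g => F'.hom (b g ⊗ₜ[k] a fun _ => (List.ofFn g).prod)
  refine (hl.add_d H).eq hr fun g => ?_
  obtain ⟨X, rfl⟩ := exists_re _ g
  have hH (X : ℕ → G) : H (re p X) = F'.hom (b (re p X) ⊗ₜ[k] a fun _ => prd p X) := rfl
  have hd : (inhomogeneousCochains.d C p H : (Fin (p + 1) → G) → C) (re (p + 1) X) = _ :=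
    d_re C p H X
  have hb0 : _ = (0 : B) := (d_re B p b X).symm.trans congr($(hb.d_eq_zero) (re (p + 1) X))
  -- The cocycle condition of `a` at the pair `(s, t)`, read as the crossed homomorphism rule.
  have ha0 (s t : G) : a (fun _ => s * t) = a (fun _ => s) + A.ρ s (a fun _ => t) := by
    have h1 : _ = (0 : A) := (d_re A 1 a _).symm.trans
      congr($(ha.d_eq_zero) (re 2 (fun i => if i = 0 then s else t)))
    have e1 : re 1 (sh 1 fun i => if i = 0 then s else t) = fun _ => t := by
      funext i; simp [re, sh]
    have e2 : re 1 (ct 0 fun i => if i = 0 then s else t) = fun _ => s * t := by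
      funext i; simp [re, ct]
    have e3 : re 1 (ct 1 fun i => if i = 0 then s else t) = fun _ => s := by
      funext i; simp [re, ct]
    simp only [Finset.sum_range_succ, Finset.sum_range_zero, e1, e2, e3] at h1
    have h2 : A.ρ s (a fun _ => t) - a (fun _ => s * t) + a (fun _ => s) = 0 := by
      rw [← h1]
      simp
      abel
    rw [← sub_eq_zero, ← neg_eq_zero, ← h2]
    abel
  have hρ (s : G) (v : B) (w : A) :
      C.ρ s (F'.hom (v ⊗ₜ[k] w)) = F'.hom (B.ρ s v ⊗ₜ[k] A.ρ s w) :=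
    (Rep.hom_comm_apply F' s (v ⊗ₜ[k] w)).symm
  have hs (r : k) (v : B) (w : A) : F'.hom ((r • v) ⊗ₜ[k] w) = r • F'.hom (v ⊗ₜ[k] w) :=
    map_smul F'.hom r (v ⊗ₜ[k] w)
  rw [Pi.add_apply, hd, hH]
  rw [Pi.smul_apply, cup_re, cup_re]
  have e0 : re 1 X = fun _ => X 0 := by funext i; simp [re]
  have e7 : re 1 (sh p X) = fun _ => X p := by funext i; simp [re, sh]
  have hP : prd 1 X = X 0 := by rw [prd_succ]; simp [prd]
  have e4 : A.ρ (X 0) (a fun _ => prd p (sh 1 X)) =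
      a (fun _ => prd (p + 1) X) - a (fun _ => X 0) := by
    rw [prd_succ', ha0, add_sub_cancel_left]
  have e5 : A.ρ (prd p X) (a fun _ => X p) =
      a (fun _ => prd (p + 1) X) - a (fun _ => prd p X) := by
    rw [prd_succ, ha0, add_sub_cancel_left]
  -- Merging two neighbouring arguments leaves the total product unchanged, except in the last term,
  -- where the final argument is dropped. Completing the sum with `a(P)` in that term too costs the
  -- second summand, and the completed sum is then evaluated by the cocycle condition of `b`.
  have e6 : ∑ c ∈ Finset.range (p + 1), (-1 : k) ^ (c + 1) • H (re p (ct c X)) =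
      F'.hom ((∑ c ∈ Finset.range (p + 1), (-1 : k) ^ (c + 1) • b (re p (ct c X))) ⊗ₜ[k]
        a fun _ => prd (p + 1) X) + (-1 : k) ^ p • F'.hom (b (re p X) ⊗ₜ[k]
          (a (fun _ => prd (p + 1) X) - a fun _ => prd p X)) := by
    rw [Finset.sum_range_succ, Finset.sum_range_succ, re_ct_le p p le_rfl, hH,
      Finset.sum_congr rfl fun c hc => by rw [hH, prd_ct p c (Finset.mem_range.1 hc)]]
    simp only [TensorProduct.add_tmul, TensorProduct.sum_tmul, TensorProduct.tmul_sub, map_add,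
      map_sum, map_sub, map_neg, hs, pow_succ, mul_neg, mul_one, neg_smul,
      TensorProduct.neg_tmul, smul_sub]
    abel
  rw [hF, e0, e7, hP, hρ, e4, e5, e6, eq_neg_of_add_eq_zero_right hb0]
  simp only [TensorProduct.neg_tmul, TensorProduct.tmul_sub, map_sub, map_neg]
  abel

end Representatives

/-! ### Identities between maps of tensor powers. -/

section TensorPowers

variable {k : Type u} [CommRing k]

/-- Together with `toTensorAlgebra_cast` and the injectivity of `toTensorAlgebra`, this moves
equations between tensor powers into the tensor algebra, where index casts disappear and
associativity is `mul_assoc`. -/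
theorem toTensorAlgebra_mulEquiv {n a b : ℕ} (x : T k n a) (y : T k n b) :
    TensorPower.toTensorAlgebra (TensorPower.mulEquiv (x ⊗ₜ[k] y)) =
      TensorPower.toTensorAlgebra x * TensorPower.toTensorAlgebra y := by
  rw [← TensorPower.toTensorAlgebra_gMul, TensorPower.gMul_def]

theorem toTensorAlgebra_cast {n a b : ℕ} (h : a = b) (x : T k n a) :
    TensorPower.toTensorAlgebra (TensorPower.cast k (Fin n → k) h x) =
      TensorPower.toTensorAlgebra x := by
  subst h
  rw [TensorPower.cast_refl]
  rfl

theorem mulEquiv_induction {n a b : ℕ} {P : T k n (a + b) → Prop} (zero : P 0)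
    (add : ∀ x y, P x → P y → P (x + y))
    (mul : ∀ x y, P (TensorPower.mulEquiv (x ⊗ₜ[k] y))) (t : T k n (a + b)) : P t := by
  obtain ⟨t, rfl⟩ := TensorPower.mulEquiv.surjective t
  induction t using TensorProduct.induction_on with
  | zero => rwa [map_zero]
  | add x y hx hy => rw [map_add]; exact add _ _ hx hy
  | tmul x y => exact mul x y

theorem linearMap_ext_mulEquiv {n a b : ℕ} {M : Type*} [AddCommMonoid M] [Module k M]
    {f g : T k n (a + b) →ₗ[k] M}
    (h : ∀ x y, f (TensorPower.mulEquiv (x ⊗ₜ[k] y)) = g (TensorPower.mulEquiv (x ⊗ₜ[k] y))) :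
    f = g :=
  LinearMap.ext fun t => mulEquiv_induction (P := fun t => f t = g t) (by simp)
    (fun x y hx hy => by rw [map_add, map_add, hx, hy]) h t

theorem tens_id (n a b : ℕ) :
    tens (LinearMap.id : T k n a →ₗ[k] T k n a) (LinearMap.id : T k n b →ₗ[k] T k n b) =
      LinearMap.id :=
  linearMap_ext_mulEquiv fun x y => by rw [tens_mulEquiv]; rfl

theorem tens_smul_left {n a b c d : ℕ} (r : k) (f : T k n a →ₗ[k] T k n b)
    (g : T k n c →ₗ[k] T k n d) : tens (r • f) g = r • tens f g :=
  linearMap_ext_mulEquiv fun x y => by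
    rw [tens_mulEquiv, LinearMap.smul_apply, LinearMap.smul_apply, tens_mulEquiv,
      ← TensorProduct.smul_tmul', map_smul]

theorem tens_add_left {n a b c d : ℕ} (f f' : T k n a →ₗ[k] T k n b)
    (g : T k n c →ₗ[k] T k n d) : tens (f + f') g = tens f g + tens f' g :=
  linearMap_ext_mulEquiv fun x y => by
    rw [tens_mulEquiv, LinearMap.add_apply, LinearMap.add_apply, tens_mulEquiv, tens_mulEquiv,
      TensorProduct.add_tmul, map_add]

theorem tens_zero_left {n a b c d : ℕ} (g : T k n c →ₗ[k] T k n d) :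
    tens (0 : T k n a →ₗ[k] T k n b) g = 0 := by
  simpa using tens_smul_left (0 : k) (0 : T k n a →ₗ[k] T k n b) g

theorem tensOne_hom (n r : ℕ) (u : T k n 1 →ₗ[k] T k n 2) :
    ((tensOne n r).hom u : T k n (r + 1) →ₗ[k] T k n (r + 2)) =
      (TensorPower.cast k (Fin n → k) (add_comm 2 r)).toLinearMap ∘ₗ
        tens u (LinearMap.id : T k n r →ₗ[k] T k n r) ∘ₗ
          (TensorPower.cast k (Fin n → k) (add_comm r 1)).toLinearMap := rfl

/-- The factor on which `u` acts is split off on the left, giving the index `1 + r`, whereas the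
source of `tensOne` is indexed by `r + 1`; hence the casts. -/
theorem tensOne_cast_mulEquiv {n r : ℕ} (u : T k n 1 →ₗ[k] T k n 2) (x : T k n 1) (y : T k n r) :
    ((tensOne n r).hom u : T k n (r + 1) →ₗ[k] T k n (r + 2))
      (TensorPower.cast k (Fin n → k) (add_comm 1 r) (TensorPower.mulEquiv (x ⊗ₜ[k] y))) =
      TensorPower.cast k (Fin n → k) (add_comm 2 r) (TensorPower.mulEquiv (u x ⊗ₜ[k] y)) := by
  rw [tensOne_hom, LinearMap.comp_apply, LinearMap.comp_apply, LinearEquiv.coe_coe,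
    LinearEquiv.coe_coe, TensorPower.cast_cast, TensorPower.cast_refl]
  exact congrArg _ (tens_mulEquiv u LinearMap.id x y)

/-- Associativity of the tensor product: on `x ⊗ y ⊗ z` with `x` and `z` of degree one, both sides
give `u(x) ⊗ y ⊗ z`. -/
theorem tensOne_succ (n r : ℕ) (u : T k n 1 →ₗ[k] T k n 2) :
    ((tensOne n (r + 1)).hom u : T k n (r + 1 + 1) →ₗ[k] T k n (r + 2 + 1)) =
      tens ((tensOne n r).hom u : T k n (r + 1) →ₗ[k] T k n (r + 2))
        (LinearMap.id : T k n 1 →ₗ[k] T k n 1) := by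
  refine linearMap_ext_mulEquiv fun t z => ?_
  -- Reindexing by `1 + r` makes it possible to split off the first factor of `t`, the one on which
  -- `u` acts.
  obtain ⟨t, rfl⟩ := (TensorPower.cast k (Fin n → k) (add_comm 1 r)).surjective t
  refine mulEquiv_induction (P := fun t => ((tensOne n (r + 1)).hom u : T k n (r + 1 + 1) →ₗ[k] _)
    (TensorPower.mulEquiv (TensorPower.cast k (Fin n → k) (add_comm 1 r) t ⊗ₜ[k] z)) =
    tens ((tensOne n r).hom u : T k n (r + 1) →ₗ[k] T k n (r + 2)) LinearMap.id
    (TensorPower.mulEquiv (TensorPower.cast k (Fin n → k) (add_comm 1 r) t ⊗ₜ[k] z)))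
    (by simp) (fun x y hx hy => ?_) (fun x y => ?_) t
  · rw [map_add, TensorProduct.add_tmul, map_add, map_add, hx, hy, map_add]
  · have h : TensorPower.mulEquiv (TensorPower.cast k (Fin n → k) (add_comm 1 r)
        (TensorPower.mulEquiv (x ⊗ₜ[k] y)) ⊗ₜ[k] z) = TensorPower.cast k (Fin n → k)
          (add_comm 1 (r + 1)) (TensorPower.mulEquiv (x ⊗ₜ[k] TensorPower.mulEquiv (y ⊗ₜ[k] z))) := by
      apply toTensorAlgebra_injective
      simp only [toTensorAlgebra_mulEquiv, toTensorAlgebra_cast, mul_assoc]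
    have h' : TensorPower.cast k (Fin n → k) (show 2 + (r + 1) = r + 2 + 1 by omega)
        (TensorPower.mulEquiv (u x ⊗ₜ[k] TensorPower.mulEquiv (y ⊗ₜ[k] z))) =
        TensorPower.mulEquiv (TensorPower.cast k (Fin n → k) (add_comm 2 r)
          (TensorPower.mulEquiv (u x ⊗ₜ[k] y)) ⊗ₜ[k] z) := by
      apply toTensorAlgebra_injective
      simp only [toTensorAlgebra_mulEquiv, toTensorAlgebra_cast, mul_assoc]
    rw [tens_mulEquiv, tensOne_cast_mulEquiv, h, tensOne_cast_mulEquiv]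
    exact h'

/-- The empty tensor is a unit for the multiplication of tensor powers. -/
theorem tensOne_zero (n : ℕ) (u : T k n 1 →ₗ[k] T k n 2) :
    ((tensOne n 0).hom u : T k n 1 →ₗ[k] T k n 2) = u := by
  refine LinearMap.ext fun x => ?_
  have h1 (a : ℕ) (x : T k n a) : TensorPower.mulEquiv (x ⊗ₜ[k]
      (PiTensorProduct.tprod k Fin.elim0 : T k n 0)) = x := by
    apply toTensorAlgebra_injective
    rw [toTensorAlgebra_mulEquiv, TensorPower.toTensorAlgebra_tprod]
    simp
  have := tensOne_cast_mulEquiv u x (PiTensorProduct.tprod k Fin.elim0 : T k n 0)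
  rw [h1, h1] at this
  simpa [TensorPower.cast_refl] using this

/-! ### Naturality in the rank, and contractions. -/

/-- `u' ⊗ 1` restricts to `u ⊗ 1` along `i` if `u'` restricts to `u`. -/
theorem tensOne_comp_tmap {n m r : ℕ} (i : (Fin n → k) →ₗ[k] (Fin m → k))
    (u : T k n 1 →ₗ[k] T k n 2) (u' : T k m 1 →ₗ[k] T k m 2)
    (h : u' ∘ₗ tmap 1 i = tmap 2 i ∘ₗ u) :
    ((tensOne m r).hom u' : T k m (r + 1) →ₗ[k] T k m (r + 2)) ∘ₗ tmap (r + 1) i =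
      tmap (r + 2) i ∘ₗ ((tensOne n r).hom u : T k n (r + 1) →ₗ[k] T k n (r + 2)) := by
  have key : tens u' LinearMap.id ∘ₗ tmap (1 + r) i = tmap (2 + r) i ∘ₗ
      tens u (LinearMap.id : T k n r →ₗ[k] T k n r) := by
    rw [tmap_add, tmap_add, ← tens_comp, ← tens_comp, h, LinearMap.id_comp, LinearMap.comp_id]
  rw [tensOne_hom, tensOne_hom, LinearMap.comp_assoc, LinearMap.comp_assoc, ← tmap_cast,
    ← LinearMap.comp_assoc _ (tmap (1 + r) i), key, ← LinearMap.comp_assoc _ _ (tmap (r + 2) i),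
    tmap_cast]
  rfl

/-- Source and target of `g` may have different ranks here, so that this and `removeAt_comp_tmap`
apply to the inclusion of the first `n` letters. -/
theorem tmap_comp_insertAt {n m l : ℕ} (j : Fin (l + 1)) (g : (Fin n → k) →ₗ[k] (Fin m → k))
    (x : Fin n → k) : tmap (l + 1) g ∘ₗ insertAt n j x = insertAt m j (g x) ∘ₗ tmap l g := by
  refine PiTensorProduct.ext (MultilinearMap.ext fun v => ?_)
  simp only [LinearMap.compMultilinearMap_apply, LinearMap.comp_apply, insertAt_tprod, tmap_tprod]
  congr 1
  funext s
  refine Fin.succAboveCases j ?_ (fun s => ?_) s <;> simp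

theorem removeAt_comp_tmap {n m q : ℕ} (i : Fin (q + 1)) (g : (Fin n → k) →ₗ[k] (Fin m → k))
    (f : Module.Dual k (Fin m → k)) :
    removeAt m i f ∘ₗ tmap (q + 1) g = tmap q g ∘ₗ removeAt n i (f ∘ₗ g) := by
  refine PiTensorProduct.ext (MultilinearMap.ext fun v => ?_)
  simp only [LinearMap.compMultilinearMap_apply, LinearMap.comp_apply, removeAt_tprod, tmap_tprod,
    map_smul]
  rfl

theorem tmap_proj_comp_tmap_incl (n q : ℕ) :
    tmap q (abMap k (proj n)) ∘ₗ tmap q (abMap k (incl n)) = LinearMap.id := by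
  rw [← tmap_comp, ← abMap_comp, proj_incl, abMap_id, tmap_id]

theorem abMap_incl_single (n : ℕ) (a : Fin n) :
    abMap k (incl n) (Pi.single a 1) = Pi.single a.castSucc 1 := by
  simp [incl]

/-- Contraction is compatible with restriction to the first `n` letters for maps that vanish on
the last basis vector. -/
theorem compress_contraction {n q : ℕ} (F : T k n 1 →ₗ[k] T k n (q + 1))
    (F' : T k (n + 1) 1 →ₗ[k] T k (n + 1) (q + 1))
    (h : F' ∘ₗ tmap 1 (abMap k (incl n)) = tmap (q + 1) (abMap k (incl n)) ∘ₗ F)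
    (h0 : F' (PiTensorProduct.tprod k fun _ => Pi.single (Fin.last n) 1) = 0) (i : Fin (q + 1)) :
    tmap q (abMap k (proj n)) ∘ₗ contraction (n + 1) (l := 0) i 0 F' ∘ₗ tmap 0 (abMap k (incl n)) =
      contraction n (l := 0) i 0 F := by
  -- The summand of the trace at the last basis vector vanishes.
  have hl : F' ∘ₗ insertAt (n + 1) (l := 0) 0 (Pi.single (Fin.last n) 1) = 0 := by
    refine PiTensorProduct.ext (MultilinearMap.ext fun v => ?_)
    simp only [LinearMap.compMultilinearMap_apply, LinearMap.comp_apply, insertAt_tprod]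
    refine (congrArg (fun w => F' (PiTensorProduct.tprod k w)) (funext fun s => ?_)).trans h0
    rw [Subsingleton.elim s 0, Fin.insertNth_apply_same]
  have hc (a : Fin n) : removeAt (n + 1) i (LinearMap.proj a.castSucc) ∘ₗ F' ∘ₗ
      insertAt (n + 1) (l := 0) 0 (Pi.single a.castSucc 1) ∘ₗ tmap 0 (abMap k (incl n)) =
      tmap q (abMap k (incl n)) ∘ₗ removeAt n i (LinearMap.proj a) ∘ₗ F ∘ₗ
        insertAt n (l := 0) 0 (Pi.single a 1) := by
    -- A coordinate form among the first `n` restricts along the inclusion to the same coordinate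
    -- form.
    have hp : (LinearMap.proj a.castSucc : (Fin (n + 1) → k) →ₗ[k] k) ∘ₗ abMap k (incl n) =
        LinearMap.proj a :=
      (Pi.basisFun k (Fin n)).ext fun b => by
        rw [Pi.basisFun_apply, LinearMap.comp_apply, abMap_incl_single]
        simp [Pi.single_apply]
    rw [← abMap_incl_single, ← tmap_comp_insertAt, ← LinearMap.comp_assoc _ _ F', h,
      LinearMap.comp_assoc, ← LinearMap.comp_assoc _ (tmap _ _) (removeAt _ _ _),
      removeAt_comp_tmap, hp, LinearMap.comp_assoc]
  refine LinearMap.ext fun t => ?_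
  simp only [contraction, LinearMap.coe_mk, AddHom.coe_mk, Fin.sum_univ_castSucc, hl,
    LinearMap.comp_zero, add_zero, LinearMap.comp_apply, LinearMap.sum_apply, map_sum]
  refine Finset.sum_congr rfl fun a _ => ?_
  have h1 := congr($(hc a) t)
  simp only [LinearMap.comp_apply] at h1
  rw [h1]
  exact congr($(tmap_proj_comp_tmap_incl n q) _)

end TensorPowers

/-! ### Cochains for Kawazumi's classes. -/

section Kawazumi

variable {k : Type u} [CommRing k]

/-- The cochain representing the cup powers of the class of a `1`-cocycle `t`. -/
def cochainPow {G : Type u} [Group G] {A : Rep.{u} k G} (t : G → A) :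
    (p : ℕ) → (Fin p → G) → tpow A p
  | 0 => fun _ => (1 : k)
  | p + 1 => cupCochain rfl (cochainPow t p) fun x : Fin 1 → G => t (x 0)

theorem IsRep.cupPow {G : Type u} [Group G] {A : Rep.{u} k G} {t : G → A}
    {x : groupCohomology A 1} (hx : IsRep (fun g : Fin 1 → G => t (g 0)) x) :
    ∀ p, IsRep (cochainPow t p) (cupPow x p)
  | 0 => isRep_invClass (A := 𝟙_ (Rep.{u} k G)) (1 : k) fun _ => rfl
  | p + 1 => (hx.cupPow p).cup rfl hx

theorem cochainPow_succ {G : Type u} [Group G] {A : Rep.{u} k G} (t : G → A) (p : ℕ)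
    (g : Fin (p + 1) → G) : cochainPow t (p + 1) g =
      cochainPow t p (fun s => g s.castSucc) ⊗ₜ[k]
        A.ρ (List.ofFn fun s : Fin p => g s.castSucc).prod (t (g (Fin.last p))) := rfl

/-- `H1π` is defined through the explicit model of `1`-cocycles, and this translates it into
inhomogeneous cochains. -/
theorem isRep_johnsonClass {n : ℕ} (θ : MagnusExpansion k n) :
    IsRep (A := coeff k n 2 1) (fun g : Fin 1 → AutF.{u} n => johnson θ (g 0)) (johnsonClass θ) := by
  refine ⟨(isoCocycles₁ (coeff k n 2 1)).inv
    ⟨johnson θ, (mem_cocycles₁_iff _).2 (johnson_mul θ)⟩, ?_, rfl⟩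
  have := congr($(isoCocycles₁_inv_comp_iCocycles (coeff k n 2 1))
    ⟨johnson θ, (mem_cocycles₁_iff _).2 (johnson_mul θ)⟩)
  exact this

/-- The Johnson class is represented by the sum of the Johnson map and a coboundary. -/
theorem isRep_johnsonClass_add {n : ℕ} (θ : MagnusExpansion k n) (D : T k n 1 →ₗ[k] T k n 2) :
    IsRep (A := coeff k n 2 1) (fun g : Fin 1 → AutF.{u} n =>
      johnson θ (g 0) + D - (coeff k n 2 1).ρ (g 0) D) (johnsonClass θ) := by
  -- The coboundary of the constant `0`-cochain `v` is `g ↦ g • v - v`, so the sign convention of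
  -- the statement requires `v = -D`.
  refine ((isRep_johnsonClass θ).add_d fun _ => -D).congr fun g => ?_
  rw [Pi.add_apply, inhomogeneousCochains.d_hom_apply]
  simp
  abel

theorem iterComp_zero (n N r : ℕ) (h : 0 + r + 1 = N) (c : k) :
    ((iterComp n N 0 r h).hom c : T k n (r + 1) →ₗ[k] T k n N) =
      c • (TensorPower.cast k (Fin n → k) (show r + 1 = N by omega)).toLinearMap := rfl

theorem iterComp_succ (n N p r : ℕ) (h : p + 1 + r + 1 = N) (w : tpow (coeff.{u} k n 2 1) p)
    (u : T k n 1 →ₗ[k] T k n 2) :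
    ((iterComp n N (p + 1) r h).hom (w ⊗ₜ[k] u) : T k n (r + 1) →ₗ[k] T k n N) =
      ((iterComp n N p (r + 1) (by omega)).hom w : T k n (r + 2) →ₗ[k] T k n N) ∘ₗ
        ((tensOne n r).hom u : T k n (r + 1) →ₗ[k] T k n (r + 2)) := rfl

/-- Adding a tensor factor to an iterated composition amounts to adding it to every factor. -/
theorem iterComp_tens (n : ℕ) : ∀ (p r N : ℕ) (h : p + r + 1 = N) (w : tpow (coeff.{u} k n 2 1) p),
    ((iterComp n (N + 1) p (r + 1) (by omega)).hom w : T k n (r + 1 + 1) →ₗ[k] T k n (N + 1)) =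
      tens ((iterComp n N p r h).hom w : T k n (r + 1) →ₗ[k] T k n N)
        (LinearMap.id : T k n 1 →ₗ[k] T k n 1)
  | 0, r, N, h, (c : k) => by
    obtain rfl : N = r + 1 := by omega
    refine (iterComp_zero n _ (r + 1) (by omega) c).trans ?_
    refine Eq.trans ?_ (congrArg (fun f => tens f _) (iterComp_zero n _ r h c).symm)
    rw [tens_smul_left, TensorPower.cast_refl, TensorPower.cast_refl]
    exact congrArg _ (tens_id n (r + 1) 1).symm
  | p + 1, r, N, h, w => by
    induction w using TensorProduct.induction_on with
    | zero =>
      refine (map_zero (iterComp n (N + 1) (p + 1) (r + 1) _).hom).trans ?_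
      exact (tens_zero_left _).symm.trans
        (congrArg (fun f => tens f _) (map_zero (iterComp n N (p + 1) r h).hom).symm)
    | add x y hx hy =>
      refine (map_add (iterComp n (N + 1) (p + 1) (r + 1) _).hom x y).trans ?_
      refine (congrArg₂ (· + ·) hx hy).trans ?_
      exact (tens_add_left _ _ _).symm.trans
        (congrArg (fun f => tens f _) (map_add (iterComp n N (p + 1) r h).hom x y).symm)
    | tmul w u =>
      rw [iterComp_succ, iterComp_succ, iterComp_tens n p (r + 1) N (by omega) w]
      refine (congrArg _ (tensOne_succ n r u)).trans ?_
      rw [← tens_comp, LinearMap.comp_id]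

/-! ### Stabilization of the classes. -/

theorem stab_inv_hom_comp_incl {n : ℕ} (φ : AutF.{u} n) :
    (stab n φ)⁻¹.hom.comp (incl n) = (incl n).comp φ⁻¹.hom := by
  rw [← map_inv, stab_hom, extend_incl]

theorem stab_inv_hom_last {n : ℕ} (φ : AutF.{u} n) :
    (stab n φ)⁻¹.hom (FreeGroup.of (Fin.last n)) = FreeGroup.of (Fin.last n) := by
  rw [← map_inv, stab_hom]
  simp [extend]

/-- Both `φ * ℤ` and its inverse commute with the inclusion, so intertwining survives the action by
conjugation. This handles the twist in the cup product. -/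
theorem coeff_ρ_stab_comp_tmap {n q l : ℕ} (φ : AutF.{u} n) {F : T k n l →ₗ[k] T k n q}
    {F' : T k (n + 1) l →ₗ[k] T k (n + 1) q}
    (h : F' ∘ₗ tmap l (abMap k (incl n)) = tmap q (abMap k (incl n)) ∘ₗ F) :
    ((coeff k (n + 1) q l).ρ (stab n φ) F' : T k (n + 1) l →ₗ[k] T k (n + 1) q) ∘ₗ
      tmap l (abMap k (incl n)) = tmap q (abMap k (incl n)) ∘ₗ
        ((coeff k n q l).ρ φ F : T k n l →ₗ[k] T k n q) := by
  have h1 : tmap l (abMap k (stab n φ)⁻¹.hom) ∘ₗ tmap l (abMap k (incl n)) =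
      tmap l (abMap k (incl n)) ∘ₗ tmap l (abMap k φ⁻¹.hom) := by
    rw [← tmap_comp, ← tmap_comp, ← abMap_comp, ← abMap_comp, stab_inv_hom_comp_incl]
  have h2 : tmap q (abMap k (stab n φ).hom) ∘ₗ tmap q (abMap k (incl n)) =
      tmap q (abMap k (incl n)) ∘ₗ tmap q (abMap k φ.hom) := by
    rw [← tmap_comp, ← tmap_comp, ← abMap_comp, ← abMap_comp, stab_hom, extend_incl]
  rw [coeff_ρ, coeff_ρ, LinearMap.comp_assoc, LinearMap.comp_assoc, h1,
    ← LinearMap.comp_assoc _ _ F', h, LinearMap.comp_assoc, ← LinearMap.comp_assoc, h2,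
    LinearMap.comp_assoc]

/-- If `t'` restricts to `t` on the first `n` letters, then so do the iterated compositions. -/
theorem iterComp_cochainPow_comp_tmap {n : ℕ} {t : AutF.{u} n → T k n 1 →ₗ[k] T k n 2}
    {t' : AutF.{u} (n + 1) → T k (n + 1) 1 →ₗ[k] T k (n + 1) 2}
    (ht : ∀ φ, t' (stab n φ) ∘ₗ tmap 1 (abMap k (incl n)) = tmap 2 (abMap k (incl n)) ∘ₗ t φ) :
    ∀ (p r N : ℕ) (h : p + r + 1 = N) (g : Fin p → AutF.{u} n),
    ((iterComp (n + 1) N p r h).hom (cochainPow (A := coeff k (n + 1) 2 1) t' p (stab n ∘ g)) :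
      T k (n + 1) (r + 1) →ₗ[k] T k (n + 1) N) ∘ₗ tmap (r + 1) (abMap k (incl n)) =
    tmap N (abMap k (incl n)) ∘ₗ
      ((iterComp n N p r h).hom (cochainPow (A := coeff k n 2 1) t p g) :
        T k n (r + 1) →ₗ[k] T k n N)
  | 0, r, N, h, g => by
    refine (congrArg (· ∘ₗ _) (iterComp_zero (n + 1) N r h 1)).trans ?_
    refine Eq.trans ?_ (congrArg (_ ∘ₗ ·) (iterComp_zero n N r h 1)).symm
    rw [one_smul, one_smul, tmap_cast]
  | p + 1, r, N, h, g => by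
    have hg : (List.ofFn fun s : Fin p => (stab n ∘ g) s.castSucc).prod =
        stab n (List.ofFn fun s : Fin p => g s.castSucc).prod := by
      rw [map_list_prod, List.map_ofFn]; rfl
    rw [cochainPow_succ, cochainPow_succ, iterComp_succ, iterComp_succ, LinearMap.comp_assoc, hg,
      Function.comp_apply, tensOne_comp_tmap _ _ _ (coeff_ρ_stab_comp_tmap _ (ht (g (Fin.last p)))),
      ← LinearMap.comp_assoc, ← LinearMap.comp_assoc]
    exact congrArg (· ∘ₗ _)
      (iterComp_cochainPow_comp_tmap ht p (r + 1) N (by omega) fun s => g s.castSucc)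

/-- The innermost map of the composite is the last factor, with no identity tensored on as `r = 0`.
It is a value of `t'` twisted by a stabilized automorphism, which fixes the last letter, so it still
kills the last basis vector. At least one factor is needed: the empty composite is the identity. -/
theorem iterComp_cochainPow_last {n : ℕ}
    {t' : AutF.{u} (n + 1) → T k (n + 1) 1 →ₗ[k] T k (n + 1) 2}
    (ht : ∀ φ : AutF.{u} n,
      t' (stab n φ) (PiTensorProduct.tprod k fun _ => Pi.single (Fin.last n) 1) = 0)
    (p N : ℕ) (h : p + 1 + 0 + 1 = N) (g : Fin (p + 1) → AutF.{u} n) :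
    ((iterComp (n + 1) N (p + 1) 0 h).hom
      (cochainPow (A := coeff k (n + 1) 2 1) t' (p + 1) (stab n ∘ g)) :
        T k (n + 1) 1 →ₗ[k] T k (n + 1) N)
      (PiTensorProduct.tprod k fun _ => Pi.single (Fin.last n) 1) = 0 := by
  have hg : (List.ofFn fun s : Fin p => (stab n ∘ g) s.castSucc).prod =
      stab n (List.ofFn fun s : Fin p => g s.castSucc).prod := by
    rw [map_list_prod, List.map_ofFn]; rfl
  rw [cochainPow_succ]
  refine congr($(iterComp_succ _ _ _ _ _ _ _) _).trans ?_
  rw [LinearMap.comp_apply, hg]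
  refine (congrArg _ (congr($(tensOne_zero _ _) _))).trans ?_
  rw [coeff_ρ, LinearMap.comp_apply, LinearMap.comp_apply, tmap_tprod]
  have h1 : abMap k (stab n (List.ofFn fun s : Fin p => g s.castSucc).prod)⁻¹.hom
      (Pi.single (Fin.last n) 1) = Pi.single (Fin.last n) 1 := by
    rw [abMap_single, stab_inv_hom_last, ab_of]
  rw [h1]
  refine (congrArg _ (congrArg _ (ht _))).trans ?_
  rw [map_zero, map_zero]

theorem linearMap_ext_single {n : ℕ} {M : Type*} [AddCommMonoid M] [Module k M]
    {f g : T k n 1 →ₗ[k] M} (h : ∀ a, f (PiTensorProduct.tprod k fun _ => Pi.single a 1) =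
      g (PiTensorProduct.tprod k fun _ => Pi.single a 1)) : f = g := by
  have : f ∘ₗ (PiTensorProduct.subsingletonEquiv (R := k) (s := fun _ => Fin n → k)
      (0 : Fin 1)).symm.toLinearMap = g ∘ₗ (PiTensorProduct.subsingletonEquiv (R := k)
        (s := fun _ => Fin n → k) (0 : Fin 1)).symm.toLinearMap :=
    (Pi.basisFun k (Fin n)).ext fun a => by
      rw [Pi.basisFun_apply, LinearMap.comp_apply, LinearMap.comp_apply, LinearEquiv.coe_coe,
        PiTensorProduct.subsingletonEquiv_symm_apply']
      exact h a
  refine LinearMap.ext fun t => ?_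
  obtain ⟨x, rfl⟩ := (PiTensorProduct.subsingletonEquiv (R := k) (s := fun _ => Fin n → k)
    (0 : Fin 1)).symm.surjective t
  exact congr($this x)

/-- The Johnson map of level `n + 1` can be modified by a coboundary so that it restricts to the
Johnson map of level `n` and vanishes on the last basis vector. -/
theorem exists_johnson_stab {n : ℕ} (θ : MagnusExpansion k n) (θ' : MagnusExpansion k (n + 1)) :
    ∃ D : T k (n + 1) 1 →ₗ[k] T k (n + 1) 2,
      (∀ φ : AutF.{u} n, (johnson θ' (stab n φ) + D - (coeff k (n + 1) 2 1).ρ (stab n φ) D :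
        T k (n + 1) 1 →ₗ[k] T k (n + 1) 2) ∘ₗ tmap 1 (abMap k (incl n)) =
          tmap 2 (abMap k (incl n)) ∘ₗ johnson θ φ) ∧
      ∀ φ : AutF.{u} n, (johnson θ' (stab n φ) + D - (coeff k (n + 1) 2 1).ρ (stab n φ) D :
        T k (n + 1) 1 →ₗ[k] T k (n + 1) 2)
          (PiTensorProduct.tprod k fun _ => Pi.single (Fin.last n) 1) = 0 := by
  -- Chosen so that `θ'₂ + d ∘ ab` equals `i^{⊗ 2} θ₂` on the first `n` letters and zero on the last
  -- one.
  let d : (Fin (n + 1) → k) →ₗ[k] T k (n + 1) 2 := (Pi.basisFun k (Fin (n + 1))).constr k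
    (Fin.lastCases (-θ'.comp 2 (FreeGroup.of (Fin.last n))) fun a =>
      tmap 2 (abMap k (incl n)) (θ.comp 2 (FreeGroup.of a)) - θ'.comp 2 (FreeGroup.of a.castSucc))
  have hd (a) : d (Pi.single a 1) = _ :=
    (congrArg d (Pi.basisFun_apply k _ a).symm).trans (Module.Basis.constr_basis _ k _ a)
  obtain ⟨D, hD⟩ : ∃ D : T k (n + 1) 1 →ₗ[k] T k (n + 1) 2,
      ∀ v, D (PiTensorProduct.tprod k fun _ => v) = d v := by
    refine ⟨d ∘ₗ (PiTensorProduct.subsingletonEquiv (0 : Fin 1)).toLinearMap, fun v => ?_⟩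
    simp only [LinearMap.comp_apply, LinearEquiv.coe_coe]
    rw [PiTensorProduct.subsingletonEquiv_apply_tprod]
  -- Neither `θ₂` nor `θ'₂` is additive, but their defects `[x] ⊗ [y]` correspond under the
  -- inclusion. The difference is therefore additive and determined by the letters.
  have hincl (γ : FreeGroup (Fin n)) : d (ab k (incl n γ)) =
      tmap 2 (abMap k (incl n)) (θ.comp 2 γ) - θ'.comp 2 (incl n γ) := by
    refine eq_of_additive (fun γ => d (ab k (incl n γ)))
      (fun γ => tmap 2 (abMap k (incl n)) (θ.comp 2 γ) - θ'.comp 2 (incl n γ))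
      (fun x y => by simp) (fun x y => ?_) (fun a => ?_) γ
    · have h1 := tmap_tprod (abMap k (incl n)) ![ab k x, ab k y]
      have h2 : (fun s => abMap k (incl n) (![ab k x, ab k y] s)) =
          ![ab k (incl n x), ab k (incl n y)] := by
        funext s; fin_cases s <;> simp
      rw [h2] at h1
      simp only [map_mul, θ.comp_two, θ'.comp_two, map_add, h1]
      abel
    · simp only [incl, FreeGroup.map.of, ab_of, hd, Fin.lastCases_castSucc]
  -- The modified cocycle is given by the Johnson formula with `θ'₂` replaced by `θ'₂ + d ∘ ab`.
  have key (φ : AutF.{u} n) (γ : FreeGroup (Fin (n + 1))) :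
      (johnson θ' (stab n φ) + D - (coeff k (n + 1) 2 1).ρ (stab n φ) D :
        T k (n + 1) 1 →ₗ[k] T k (n + 1) 2) (PiTensorProduct.tprod k fun _ => ab k γ) =
      (θ'.comp 2 γ + d (ab k γ)) - tmap 2 (abMap k (stab n φ).hom)
        (θ'.comp 2 ((stab n φ)⁻¹.hom γ) + d (ab k ((stab n φ)⁻¹.hom γ))) := by
    rw [coeff_ρ, LinearMap.sub_apply, LinearMap.add_apply, johnson_ab, LinearMap.comp_apply,
      LinearMap.comp_apply, tmap_tprod, hD, hD, abMap_ab, johnsonAux, map_add]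
    abel
  refine ⟨D, fun φ => linearMap_ext_single fun a => ?_, fun φ => ?_⟩
  · have h1 (γ) : (stab n φ)⁻¹.hom (incl n γ) = incl n (φ⁻¹.hom γ) :=
      congr($(stab_inv_hom_comp_incl φ) γ)
    have h2 (t) : tmap 2 (abMap k (stab n φ).hom) (tmap 2 (abMap k (incl n)) t) =
        tmap 2 (abMap k (incl n)) (tmap 2 (abMap k φ.hom) t) := by
      rw [← LinearMap.comp_apply, ← tmap_comp, ← abMap_comp, stab_hom, extend_incl, abMap_comp,
        tmap_comp, LinearMap.comp_apply]
    rw [LinearMap.comp_apply, LinearMap.comp_apply, tmap_tprod, ← ab_of, abMap_ab, key, h1, hincl,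
      hincl, johnson_ab, johnsonAux, add_sub_cancel, add_sub_cancel, h2, map_sub]
  · rw [← ab_of, key, stab_inv_hom_last, ab_of, hd, Fin.lastCases_last, add_neg_cancel, map_zero,
      sub_zero]

/-- Any cocycle `t` in the Johnson class may be used, in particular the one modified by a
coboundary. -/
theorem isRep_kawazumiClass {n : ℕ} {θ : MagnusExpansion k n}
    {t : AutF.{u} n → T k n 1 →ₗ[k] T k n 2}
    (ht : IsRep (A := coeff k n 2 1) (fun g : Fin 1 → AutF.{u} n => t (g 0)) (johnsonClass θ))
    (p : ℕ) : IsRep (A := coeff k n (p + 1) 1) (fun g : Fin p → AutF.{u} n =>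
      (varsigma n p).hom (cochainPow (A := coeff k n 2 1) t p g)) (kawazumiClass θ p) :=
  (IsRep.cupPow (A := coeff k n 2 1) ht p).coh (varsigma n p)

/-- The stabilization maps carry Kawazumi's classes to each other. -/
theorem alpha_kawazumiClass {n : ℕ} (θ : MagnusExpansion k n) (θ' : MagnusExpansion k (n + 1))
    (p : ℕ) : alpha n (p + 1) 1 p (kawazumiClass θ' p) = kawazumiClass θ p := by
  obtain ⟨D, hD, -⟩ := exists_johnson_stab θ θ'
  have h1 := (isRep_kawazumiClass (t := fun φ => johnson θ' φ + D - (coeff k (n + 1) 2 1).ρ φ D)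
    (isRep_johnsonClass_add θ' D) p).map (stab n) (compress k n (p + 1) 1)
  have h2 := isRep_kawazumiClass (isRep_johnsonClass θ) p
  refine h1.eq h2 fun g => ?_
  -- The inclusion is moved past the cochain to the left, where the projection cancels it.
  refine (congrArg (tmap (p + 1) (abMap k (proj n)) ∘ₗ ·)
    (iterComp_cochainPow_comp_tmap hD p 0 (p + 1) rfl g)).trans ?_
  rw [← LinearMap.comp_assoc, tmap_proj_comp_tmap_incl]
  exact LinearMap.id_comp _

/-- The stabilization maps carry Kawazumi's reduced classes of positive degree to each other. -/
theorem alpha_reducedKawazumiClass {n : ℕ} (θ : MagnusExpansion k n)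
    (θ' : MagnusExpansion k (n + 1)) (p : ℕ) :
    alpha n (p + 1) 0 (p + 1) (reducedKawazumiClass θ' (p + 1)) =
      reducedKawazumiClass θ (p + 1) := by
  obtain ⟨D, hD, hD0⟩ := exists_johnson_stab θ θ'
  have h1 := ((isRep_kawazumiClass (t := fun φ => johnson θ' φ + D - (coeff k (n + 1) 2 1).ρ φ D)
    (isRep_johnsonClass_add θ' D) (p + 1)).coh
      (contractionHom (n + 1) (q := p + 1) (l := 0) 0 0)).map (stab n) (compress k n (p + 1) 0)
  have h2 := (isRep_kawazumiClass (isRep_johnsonClass θ) (p + 1)).coh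
    (contractionHom n (q := p + 1) (l := 0) 0 0)
  refine h1.eq h2 fun g => ?_
  exact compress_contraction _ _ (iterComp_cochainPow_comp_tmap hD (p + 1) 0 (p + 2) rfl g)
    (iterComp_cochainPow_last hD0 p (p + 2) rfl g) 0

/-! ### The recursion between the classes. -/

theorem kawazumiClass_one {n : ℕ} (θ : MagnusExpansion k n) :
    kawazumiClass θ 1 = johnsonClass θ := by
  refine (isRep_kawazumiClass (isRep_johnsonClass θ) 1).eq (isRep_johnsonClass θ) fun g => ?_
  refine (iterComp_succ n 2 0 0 rfl (1 : k) _).trans ?_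
  refine (congrArg₂ (· ∘ₗ ·) (iterComp_zero n 2 1 rfl 1) (tensOne_zero n _)).trans ?_
  rw [one_smul, TensorPower.cast_refl]
  refine (LinearMap.id_comp _).trans ?_
  simp

theorem gammaHom_tmul {n q l m : ℕ} (g : T k n m →ₗ[k] T k n l) (f : T k n l →ₗ[k] T k n q) :
    (gammaHom n q l m).hom (g ⊗ₜ[k] f) = f ∘ₗ g := rfl

theorem compHom_tmul {n q l m : ℕ} (f : T k n l →ₗ[k] T k n q) (g : T k n m →ₗ[k] T k n l) :
    (compHom n q l m).hom (f ⊗ₜ[k] g) = f ∘ₗ g := rfl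

/-- The identity is invariant, so the twist in the cup product does not affect it. -/
theorem isRep_hcomp_idClass {n q l i : ℕ} {x : groupCohomology (coeff k n q l) i}
    {c : (Fin i → AutF.{u} n) → T k n l →ₗ[k] T k n q} (hc : IsRep (A := coeff k n q l) c x)
    (r : ℕ) : IsRep (A := coeff k n (q + r) (l + r))
      (fun g => tens (c g) (LinearMap.id : T k n r →ₗ[k] T k n r))
      (hcompLevel (add_zero i) x (idClass n r)) := by
  have hI : IsRep (A := coeff k n r r) (fun _ => LinearMap.id) (idClass n r) := isRep_invClass _ _
  refine ((hc.cup (add_zero i) hI).coh (tensHom n q l r r)).congr fun g => ?_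
  refine congrArg (tens (c g)) ?_
  rw [coeff_ρ, LinearMap.id_comp, tmap_hom_inv]

/-- The recursion `h₁ ∘ (h_p ⊗ 1) = (-1)ᵖ h_{p + 1}`. -/
theorem vcompLevel_johnsonClass {n : ℕ} (θ : MagnusExpansion k n) (p : ℕ) :
    vcompLevel (q := p + 1 + 1) (l := 2) (m := 1) (add_comm 1 p) (johnsonClass θ)
      (hcompLevel (l₁ := 1) (l₂ := 1) (add_zero p) (kawazumiClass θ p) (idClass n 1)) =
      (-1 : k) ^ p • kawazumiClass θ (p + 1) := by
  -- Swapping the cup factors turns `g ⊗ f ↦ f ∘ g` into `f ⊗ g ↦ f ∘ g` and produces the whole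
  -- sign; what remains is an equality of cochains.
  refine (coh_cup_comm (gammaHom n (p + 1 + 1) 2 1) (compHom n (p + 1 + 1) 2 1)
    (fun g f => (gammaHom_tmul g f).trans (compHom_tmul f g).symm) _ _).trans (congrArg _ ?_)
  let K (g : Fin p → AutF.{u} n) : T k n 1 →ₗ[k] T k n (p + 1) :=
    (varsigma n p).hom (cochainPow (A := coeff k n 2 1) (johnson θ) p g)
  have hK : IsRep (A := coeff k n (p + 1) 1) K (kawazumiClass θ p) :=
    isRep_kawazumiClass (isRep_johnsonClass θ) p
  have hH : IsRep (A := coeff k n (p + 1 + 1) 2)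
      (fun g => tens (K g) (LinearMap.id : T k n 1 →ₗ[k] T k n 1))
      (hcompLevel (l₁ := 1) (l₂ := 1) (add_zero p) (kawazumiClass θ p) (idClass n 1)) :=
    isRep_hcomp_idClass hK 1
  have h0 := IsRep.cup (A := coeff k n (p + 1 + 1) 2) (B := coeff k n 2 1) (m := p + 1) rfl hH
    (isRep_johnsonClass θ)
  have h1 := h0.coh (compHom n (p + 1 + 1) 2 1)
  refine h1.eq (isRep_kawazumiClass (isRep_johnsonClass θ) (p + 1)) fun g => ?_
  rw [cochainPow_succ]
  refine Eq.trans ?_ (iterComp_succ n (p + 1 + 1) p 0 rfl _ _).symm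
  exact (congrArg₂ (· ∘ₗ ·) (iterComp_tens n p 0 (p + 1) rfl _) (tensOne_zero n _)).symm

end Kawazumi

end StableAut

/-! ### Assembly of the stable classes. -/

theorem mainTheorem7 {k : Type u} [CommRing k] (θ : ∀ n : ℕ, StableAut.MagnusExpansion k n) :
    ∃ (h : ∀ p : ℕ, StableAut.StableCoh k (p + 1) 1 p)
      (hbar : ∀ p : ℕ, StableAut.StableCoh k p 0 p),
      (∀ n : ℕ, (h 1).1 n = StableAut.johnsonClass (θ n)) ∧
      (∀ p : ℕ, 1 ≤ p → ∀ n : ℕ,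
        (h p).1 n = StableAut.kawazumiClass (θ n) p ∧
        (hbar p).1 n = StableAut.reducedKawazumiClass (θ n) p) ∧
      (∀ p : ℕ, 1 ≤ p →
        StableAut.StableCoh.IsVComp (add_comm 1 p) (h 1)
          (StableAut.StableCoh.hcomp (add_zero p) (h p) (StableAut.StableCoh.one k 1))
          ((-1 : k) ^ p • h (p + 1))) ∧
      (∀ p : ℕ, 1 ≤ p → StableAut.StableCoh.IsContraction 0 0 (h p) (hbar p)) ∧
      (∀ p : ℕ, 1 ≤ p →
        h p ∈ (StableAut.generated (h 1)).carrier (p + 1) 1 p ∧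
        hbar p ∈ (StableAut.generated (h 1)).carrier p 0 p) := by
  obtain ⟨h, hh⟩ : ∃ h : ∀ p : ℕ, StableAut.StableCoh k (p + 1) 1 p,
      ∀ p n, (h p).1 n = StableAut.kawazumiClass (θ n) p :=
    ⟨fun p => ⟨fun n => StableAut.kawazumiClass (θ n) p,
      fun n => StableAut.alpha_kawazumiClass (θ n) (θ (n + 1)) p⟩, fun _ _ => rfl⟩
  obtain ⟨hbar, hhbar⟩ : ∃ hbar : ∀ p : ℕ, StableAut.StableCoh k p 0 p,
      ∀ p, 1 ≤ p → ∀ n, (hbar p).1 n = StableAut.reducedKawazumiClass (θ n) p := by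
    have (p : ℕ) : ∃ x : StableAut.StableCoh k p 0 p,
        1 ≤ p → ∀ n, x.1 n = StableAut.reducedKawazumiClass (θ n) p := by
      cases p with
      | zero => exact ⟨0, fun hp => absurd hp (by simp)⟩
      | succ p => exact ⟨⟨fun n => StableAut.reducedKawazumiClass (θ n) (p + 1),
          fun n => StableAut.alpha_reducedKawazumiClass (θ n) (θ (n + 1)) p⟩, fun _ _ => rfl⟩
    exact ⟨fun p => (this p).choose, fun p => (this p).choose_spec⟩
  have h1 (n : ℕ) : (h 1).1 n = StableAut.johnsonClass (θ n) :=
    (hh 1 n).trans (StableAut.kawazumiClass_one (θ n))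
  have hv (p : ℕ) : StableAut.StableCoh.IsVComp (add_comm 1 p) (h 1)
      (StableAut.StableCoh.hcomp (add_zero p) (h p) (StableAut.StableCoh.one k 1))
      ((-1 : k) ^ p • h (p + 1)) := by
    refine Filter.Eventually.of_forall fun n => ?_
    have hz : ((-1 : k) ^ p • h (p + 1)).1 n =
        (-1 : k) ^ p • StableAut.kawazumiClass (θ n) (p + 1) := congrArg _ (hh (p + 1) n)
    have hy : (StableAut.StableCoh.hcomp (add_zero p) (h p) (StableAut.StableCoh.one k 1)).1 n =
        StableAut.hcompLevel (add_zero p) (StableAut.kawazumiClass (θ n) p)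
          (StableAut.idClass n 1) :=
      congrArg (fun x => StableAut.hcompLevel (add_zero p) x (StableAut.idClass n 1)) (hh p n)
    rw [hz, h1, hy]
    exact (StableAut.vcompLevel_johnsonClass (θ n) p).symm
  have hc (p : ℕ) (hp : 1 ≤ p) : StableAut.StableCoh.IsContraction 0 0 (h p) (hbar p) :=
    Filter.Eventually.of_forall fun n => (hhbar p hp n).trans (congrArg _ (hh p n).symm)
  have hgen : h 1 ∈ (StableAut.generated (h 1)).carrier 2 1 1 := by
    simp only [StableAut.generated, Submodule.mem_iInf]
    exact fun S hS => hS
  have hmem (p : ℕ) (hp : 1 ≤ p) : h p ∈ (StableAut.generated (h 1)).carrier (p + 1) 1 p := by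
    generalize StableAut.generated (h 1) = S at hgen
    induction p, hp using Nat.le_induction with
    | base => exact hgen
    | succ p _ ih =>
      have hy : StableAut.StableCoh.hcomp (add_zero p) (h p) (StableAut.StableCoh.one k 1) ∈
          S.carrier (p + 1 + 1) (1 + 1) p := S.hcomp_mem (add_zero p) ih (S.one_mem 1)
      have hz : (-1 : k) ^ p • h (p + 1) ∈ S.carrier (p + 1 + 1) 1 (p + 1) :=
        S.vcomp_mem (q := p + 1 + 1) (l := 2) (m := 1) (add_comm 1 p) hgen hy (hv p)
      -- The scalar `(-1)ᵖ` is its own inverse, so a second multiplication removes it.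
      have := Submodule.smul_mem _ ((-1 : k) ^ p) hz
      rwa [smul_smul, ← mul_pow, neg_one_mul, neg_neg, one_pow, one_smul] at this
  exact ⟨h, hbar, h1, fun p hp n => ⟨hh p n, hhbar p hp n⟩, fun p _ => hv p, hc,
    fun p hp => ⟨hmem p hp, (StableAut.generated (h 1)).contraction_mem 0 0 (hmem p hp) (hc p hp)⟩⟩
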